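/- Let $N=I\times\mathcal S_0$, $I=(a,b)$ with $-\infty\le a<b\le\infty$, be an $(n+1)$-dimensional spacetime, where $\mathcal S_0$ is a compact connected smooth $n$-manifold and the metric is $$d\bar s^2=e^{2\psi}\bigl(-(dx^0)^2+\sigma_{ij}(x^0,x)\,dx^i dx^j\bigr)$$ with $\psi$ and $\sigma_{ij}$ smooth, each $\sigma(x^0,\cdot)$ a Riemannian metric on $\mathcal S_0$, and $x^0$ a future directed time function. A closed spacelike hypersurface is a compact connected embedded hypersurface without boundary, of class at least $C^1$, whose induced metric is Riemannian; $|M|$ denotes its volume with respect to the induced metric. If $M$ is of class $C^2$, its mean curvature $H=g^{ij}h_{ij}$ is taken with respect to the past directed unit normal $\nu$, where $h_{ij}$ is given by the Gauss formula $x_{ij}=h_{ij}\nu$ (so $h_{ij}=-\langle\bar\nabla_{x_i}x_j,\nu\rangle$). Let $a_0\in I$ and suppose that in the future end $N_+=(x^0)^{-1}[a_0,b)$ the slices $M_t=\{x^0=t\}$, $a_0\le t<b$, have non-negative mean curvature, and that $$\lim_{t\to b}|M_t|=0 .$$ 1. If $(M_k)$ is any sequence of closed spacelike hypersurfaces of $N$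 that approaches $b$, i.e. $\lim_k\inf_{M_k}x^0=b$, then $\lim_k|M_k|=0$. 2. Let $(M_\tau)_{\tau>\tau_0}$ be any family of closed spacelike hypersurfaces of class $C^2$, all contained in a future end $(x^0)^{-1}[a_1,b)$ with $a_1\in I$, such that $M_\tau$ has constant mean curvature $\tau$. Then $\lim_{\tau\to\infty}|M_\tau|=0$. In particular this holds for the leaves $M_\tau$ of a foliation of a future end $\tilde N_+\subset N_+$ by closed spacelike hypersurfaces of constant mean curvature $\tau$, $\tau_0<\tau<\infty$, such as is known to exist if for some constant $\Lambda\ge0$ one has $\bar R_{\alpha\beta}\nu^\alpha\nu^\beta\ge-\Lambda$ in $N_+$ for all $\nu$ with $\langle\nu,\nu\rangle=-1$, and if there are closed spacelike hypersurfaces $M_k^+$ with $H|_{M_k^+}\to\infty$ and $\limsup_k\inf_{M_k^+}x^0>x^0(p)$ for every $p\in N$ (a future mean curvature barrier). -/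

import Mathlib

open Set Filter Topology MeasureTheory
open scoped Manifold ContDiff ENNReal

universe u v

/-- The model space `ℝⁿ`. -/
abbrev Rn (n : ℕ) : Type := EuclideanSpace ℝ (Fin n)

section Volume

variable {n : ℕ} {M : Type u} [TopologicalSpace M] [ChartedSpace (Rn n) M]

/-- The tangent vector at `c.symm y` which has the components `w` in the chart `c`
(for `w` the `i`-th unit vector this is `∂/∂xⁱ`). -/
noncomputable def coordVec (c : OpenPartialHomeomorph M (Rn n)) (y w : Rn n) :
    TangentSpace (𝓡 n) (c.symm y) :=
  mfderiv 𝓘(ℝ, Rn n) (𝓡 n) c.symm y w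

/-- The volume density `√det(g_ij)` in the chart `c`, at the point with coordinates `y`. -/
noncomputable def volDensity
    (g : ∀ x : M, TangentSpace (𝓡 n) x → TangentSpace (𝓡 n) x → ℝ)
    (c : OpenPartialHomeomorph M (Rn n)) (y : Rn n) : ℝ :=
  √(Matrix.det (Matrix.of fun i j : Fin n =>
    g (c.symm y) (coordVec c y (EuclideanSpace.single i 1))
      (coordVec c y (EuclideanSpace.single j 1))))

/-- The total volume of a compact manifold with a Riemannian metric `g`: the supremum of
`∑ᵢ ∫_{cᵢ(Aᵢ)} √det g dy` over all finite families of pairwise disjoint Borel sets `Aᵢ`, each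
contained in the domain of a chart `cᵢ`. Every summand is the volume of `Aᵢ`, and by compactness the
supremum is attained when the `Aᵢ` form a partition of the manifold. -/
noncomputable def riemVolume
    (g : ∀ x : M, TangentSpace (𝓡 n) x → TangentSpace (𝓡 n) x → ℝ) : ℝ≥0∞ :=
  ⨆ (N : ℕ) (c : Fin N → OpenPartialHomeomorph M (Rn n)) (A : Fin N → Set M)
    (_ : (∀ i, c i ∈ atlas (Rn n) M ∧ MeasurableSet[borel M] (A i) ∧ A i ⊆ (c i).source) ∧
      Pairwise fun i j => Disjoint (A i) (A j)),
    ∑ i, ∫⁻ y in c i '' A i, ENNReal.ofReal (volDensity g (c i) y)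

end Volume

/-- An `(n+1)`-dimensional spacetime `N = I × S`, `I = (a, b)`, in Gaussian coordinates: `S` is a
smooth manifold of dimension `n` and the metric is
`e^{2ψ} (-(dx⁰)² + σ_ij(x⁰, x) dxⁱ dxʲ)` with `ψ` and `σ` smooth on `I × S` and each `σ(x⁰, ·)` a
Riemannian metric. The values of `ψ` and `σ` for `x⁰ ∉ I` play no role. -/
structure GaussianSpacetime (n : ℕ) (S : Type u) [TopologicalSpace S] [ChartedSpace (Rn n) S] where
  /-- the left end point of the time interval, possibly `-∞` -/
  a : EReal
  /-- the right end point of the time interval, possibly `+∞` -/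
  b : EReal
  /-- the exponent of the conformal factor -/
  ψ : ℝ → S → ℝ
  /-- the time dependent Riemannian metric on `S` -/
  σ : ℝ → ∀ x : S, TangentSpace (𝓡 n) x →L[ℝ] TangentSpace (𝓡 n) x →L[ℝ] ℝ
  σ_symm : ∀ t : ℝ, a < t → t < b → ∀ (x : S) (v w : TangentSpace (𝓡 n) x), σ t x v w = σ t x w v
  σ_pos : ∀ t : ℝ, a < t → t < b → ∀ (x : S) (v : TangentSpace (𝓡 n) x), v ≠ 0 → 0 < σ t x v v
  ψ_smooth : ContMDiffOn (𝓘(ℝ, ℝ).prod (𝓡 n)) 𝓘(ℝ, ℝ) ∞ (fun p : ℝ × S => ψ p.1 p.2)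
    {p : ℝ × S | a < p.1 ∧ p.1 < b}
  /-- the components of `σ` with respect to every chart are smooth functions of `(x⁰, x)` -/
  σ_smooth : ∀ c ∈ atlas (Rn n) S, ∀ v w : Rn n,
    ContDiffOn ℝ ∞
      (fun z : ℝ × Rn n => σ z.1 (c.symm z.2) (coordVec c z.2 v) (coordVec c z.2 w))
      {z : ℝ × Rn n | (a < z.1 ∧ z.1 < b) ∧ z.2 ∈ c.target}

namespace GaussianSpacetime

variable {n : ℕ} {S : Type u} [TopologicalSpace S] [ChartedSpace (Rn n) S]

/-- The time interval `I = (a, b)`. -/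
def I (N : GaussianSpacetime n S) : Set ℝ := {t : ℝ | N.a < t ∧ t < N.b}

/-- The Lorentzian metric at the point `(t, x)`; a tangent vector is a pair consisting of its
`∂/∂x⁰`-component and a vector tangent to `S`. -/
noncomputable def metric (N : GaussianSpacetime n S) (t : ℝ) (x : S)
    (X Y : ℝ × TangentSpace (𝓡 n) x) : ℝ :=
  Real.exp (2 * N.ψ t x) * (-(X.1 * Y.1) + N.σ t x X.2 Y.2)

/-- A closed (compact, without boundary) connected embedded spacelike hypersurface of class `C^m`,
given by a manifold `carrier` and its embedding `ξ ↦ (time ξ, proj ξ)` into `N = I × S`; `time` is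
the restriction of `x⁰`. Since `carrier` is compact, an injective immersion is an embedding, and
the positivity of the induced metric contains that the map is an immersion. -/
structure SpacelikeHypersurface (N : GaussianSpacetime n S) (m : WithTop ℕ∞) where
  carrier : Type v
  [topologicalSpace : TopologicalSpace carrier]
  [chartedSpace : ChartedSpace (Rn n) carrier]
  [isManifold : IsManifold (𝓡 n) m carrier]
  [compactSpace : CompactSpace carrier]
  [connectedSpace : ConnectedSpace carrier]
  time : carrier → ℝ
  proj : carrier → S
  time_mem : ∀ ξ, time ξ ∈ N.I
  contMDiff_time : ContMDiff (𝓡 n) 𝓘(ℝ, ℝ) m time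
  contMDiff_proj : ContMDiff (𝓡 n) (𝓡 n) m proj
  injective : Function.Injective fun ξ => (time ξ, proj ξ)
  spacelike : ∀ (ξ : carrier) (v : TangentSpace (𝓡 n) ξ), v ≠ 0 →
    0 < N.metric (time ξ) (proj ξ)
      (mfderiv (𝓡 n) 𝓘(ℝ, ℝ) time ξ v, mfderiv (𝓡 n) (𝓡 n) proj ξ v)
      (mfderiv (𝓡 n) 𝓘(ℝ, ℝ) time ξ v, mfderiv (𝓡 n) (𝓡 n) proj ξ v)

attribute [instance] SpacelikeHypersurface.topologicalSpace SpacelikeHypersurface.chartedSpace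
  SpacelikeHypersurface.isManifold SpacelikeHypersurface.compactSpace
  SpacelikeHypersurface.connectedSpace

/-- The components of the Lorentzian metric in the coordinates `(x⁰, c)`: the product of the
coordinate vectors `X` and `Y` at the point with coordinates `z`. -/
noncomputable def coordMetric (N : GaussianSpacetime n S) (c : OpenPartialHomeomorph S (Rn n))
    (z X Y : ℝ × Rn n) : ℝ :=
  N.metric z.1 (c.symm z.2) (X.1, coordVec c z.2 X.2) (Y.1, coordVec c z.2 Y.2)

/-- The Christoffel symbols of the first kind of the Lorentzian metric in the coordinates `(x⁰, c)`:
`⟨Γ(X, Y), Z⟩ = (∂_X ⟨Y, Z⟩ + ∂_Y ⟨X, Z⟩ - ∂_Z ⟨X, Y⟩) / 2`, for constant coordinate vectors. -/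
noncomputable def christoffel (N : GaussianSpacetime n S) (c : OpenPartialHomeomorph S (Rn n))
    (z X Y Z : ℝ × Rn n) : ℝ :=
  (fderiv ℝ (fun z => N.coordMetric c z Y Z) z X + fderiv ℝ (fun z => N.coordMetric c z X Z) z Y
    - fderiv ℝ (fun z => N.coordMetric c z X Y) z Z) / 2

namespace SpacelikeHypersurface

variable {N : GaussianSpacetime n S} {m : WithTop ℕ∞}

/-- The induced metric `g`. -/
noncomputable def inducedMetric (M : N.SpacelikeHypersurface m) (ξ : M.carrier)
    (v w : TangentSpace (𝓡 n) ξ) : ℝ :=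
  N.metric (M.time ξ) (M.proj ξ)
    (mfderiv (𝓡 n) 𝓘(ℝ, ℝ) M.time ξ v, mfderiv (𝓡 n) (𝓡 n) M.proj ξ v)
    (mfderiv (𝓡 n) 𝓘(ℝ, ℝ) M.time ξ w, mfderiv (𝓡 n) (𝓡 n) M.proj ξ w)

/-- The volume `|M|`. -/
noncomputable def volume (M : N.SpacelikeHypersurface m) : ℝ≥0∞ := riemVolume M.inducedMetric

/-- The chart of `S` used near `M.proj ξ`. -/
noncomputable def ambientChart (M : N.SpacelikeHypersurface m) (ξ : M.carrier) :
    OpenPartialHomeomorph S (Rn n) := chartAt (Rn n) (M.proj ξ)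

/-- The embedding in local coordinates near `ξ`. -/
noncomputable def localRep (M : N.SpacelikeHypersurface m) (ξ : M.carrier) (η : Rn n) :
    ℝ × Rn n :=
  (M.time ((chartAt (Rn n) ξ).symm η), M.ambientChart ξ (M.proj ((chartAt (Rn n) ξ).symm η)))

/-- The coordinates of `ξ`. -/
noncomputable def center (M : N.SpacelikeHypersurface m) (ξ : M.carrier) : Rn n :=
  chartAt (Rn n) ξ ξ

/-- `ν` is the past directed unit normal of `M` at `ξ`, in coordinates. -/
def IsPastUnitNormal (M : N.SpacelikeHypersurface m) (ξ : M.carrier) (ν : ℝ × Rn n) : Prop :=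
  (∀ v : Rn n, N.coordMetric (M.ambientChart ξ) (M.localRep ξ (M.center ξ))
      (fderiv ℝ (M.localRep ξ) (M.center ξ) v) ν = 0) ∧
    N.coordMetric (M.ambientChart ξ) (M.localRep ξ (M.center ξ)) ν ν = -1 ∧ ν.1 < 0

/-- The past directed unit normal of `M` at `ξ`, in coordinates. -/
noncomputable def pastUnitNormal (M : N.SpacelikeHypersurface m) (ξ : M.carrier) : ℝ × Rn n :=
  Classical.epsilon (M.IsPastUnitNormal ξ)

/-- The first fundamental form `g_ij` at `ξ`, in coordinates. -/
noncomputable def firstForm (M : N.SpacelikeHypersurface m) (ξ : M.carrier) :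
    Matrix (Fin n) (Fin n) ℝ :=
  Matrix.of fun i j => N.coordMetric (M.ambientChart ξ) (M.localRep ξ (M.center ξ))
    (fderiv ℝ (M.localRep ξ) (M.center ξ) (EuclideanSpace.single i 1))
    (fderiv ℝ (M.localRep ξ) (M.center ξ) (EuclideanSpace.single j 1))

/-- The second fundamental form `h_ij` at `ξ` with respect to the past directed unit normal `ν`, in
coordinates: by the Gauss formula `D_i x_j = h_ij ν` (modulo tangential terms) and `⟨ν, ν⟩ = -1`,
`h_ij = -⟨D_i x_j, ν⟩ = -⟨∂_i ∂_j x + Γ(x_i, x_j), ν⟩`. -/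
noncomputable def secondForm (M : N.SpacelikeHypersurface m) (ξ : M.carrier) :
    Matrix (Fin n) (Fin n) ℝ :=
  Matrix.of fun i j =>
    -(N.coordMetric (M.ambientChart ξ) (M.localRep ξ (M.center ξ))
        (fderiv ℝ (fun η => fderiv ℝ (M.localRep ξ) η (EuclideanSpace.single j 1)) (M.center ξ)
          (EuclideanSpace.single i 1))
        (M.pastUnitNormal ξ)
      + N.christoffel (M.ambientChart ξ) (M.localRep ξ (M.center ξ))
        (fderiv ℝ (M.localRep ξ) (M.center ξ) (EuclideanSpace.single i 1))
        (fderiv ℝ (M.localRep ξ) (M.center ξ) (EuclideanSpace.single j 1))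
        (M.pastUnitNormal ξ))

/-- The mean curvature `H = g^{ij} h_ij` at `ξ` (of a hypersurface of class at least `C²`). -/
noncomputable def meanCurvature (M : N.SpacelikeHypersurface m) (ξ : M.carrier) : ℝ :=
  Matrix.trace ((M.firstForm ξ)⁻¹ * M.secondForm ξ)

end SpacelikeHypersurface

/-- The coordinate slice `M_t = {x⁰ = t}`, `t ∈ I`. -/
noncomputable def slice [IsManifold (𝓡 n) ∞ S] [CompactSpace S] [ConnectedSpace S]
    (N : GaussianSpacetime n S) (t : N.I) : N.SpacelikeHypersurface ∞ where
  carrier := S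
  time := fun _ => t
  proj := fun x => x
  time_mem := fun _ => t.2
  contMDiff_time := contMDiff_const
  contMDiff_proj := contMDiff_id
  injective := fun _ _ h => (Prod.mk.inj h).2
  spacelike := by
    intro x v hv
    have h1 : mfderiv (𝓡 n) 𝓘(ℝ, ℝ) (fun _ : S => (t : ℝ)) x v = 0 := by
      rw [mfderiv_const]; rfl
    have h2 : mfderiv (𝓡 n) (𝓡 n) (fun y : S => y) x v = v := by
      have := mfderiv_id (I := 𝓡 n) (x := x)
      exact congrArg (fun L => L v) this
    have h3 : 0 < N.σ t x v v := N.σ_pos t t.2.1 t.2.2 x v hv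
    unfold metric
    rw [h1, h2]
    have h4 : (0 : ℝ) < Real.exp (2 * N.ψ t x) * (-((0 : ℝ) * 0) + N.σ t x v v) := by
      rw [mul_zero, neg_zero, zero_add]
      exact mul_pos (Real.exp_pos _) h3
    exact h4

end GaussianSpacetime

/-! Let `G` be the Gram matrix of `e^{2ψ} σ(t, x)` in a frame fixed in `t`. The mean curvature of
the slice is `-(e^{-ψ}/2) ∂_t log det G`, so non-negative curvature says that the volume density at
each fixed `x` does not increase with time.

A closed spacelike hypersurface `M` projects injectively to `S`: spacelikeness makes the projection
a local homeomorphism, and compactness, connectedness and embeddedness exclude several sheets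
(`IsLocalHomeomorph.injective_of_height`). The induced metric is the spatial metric minus the square
of a one-form, so its determinant is at most the spatial one, and by monotonicity at most that of
any earlier slice in `N_+`. Changing variables along the projection gives `|M| ≤ |M_t|` whenever `M`
lies in the future of `M_t` and `t ≥ a₀` (`volume_le_slice`). This yields the first claim, since
late slices have small volume.

For the second claim it remains to see that `M_τ` passes every slice `M_t` as `τ → ∞`. At a minimum
of the time function on `M_τ`, comparison with the touching slice gives `τ ≤ H` of that slice
(`exists_meanCurvature_le`). Slice curvatures on `[a₁, t] × S` are bounded by compactness
(`exists_sliceCurvature_le`), so for large `τ` the minimum cannot lie before `t`. -/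

/-! ### Determinant and trace inequalities for matrices. -/

section MatrixLemmas

variable {ι : Type*} [Fintype ι] [DecidableEq ι]

/-- Jacobi's formula for the derivative of a determinant. -/
theorem Matrix.hasDerivAt_det {K : ℝ → Matrix ι ι ℝ} {K' : Matrix ι ι ℝ} {t : ℝ}
    (h : ∀ i j, HasDerivAt (fun s => K s i j) (K' i j) t) :
    HasDerivAt (fun s => (K s).det) ((K t).adjugate * K').trace t := by
  have h1 : HasDerivAt (fun s => ∑ σ : Equiv.Perm ι, (Equiv.Perm.sign σ : ℝ) * ∏ i, K s (σ i) i)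
      (∑ σ : Equiv.Perm ι, (Equiv.Perm.sign σ : ℝ) *
        ∑ i, (∏ j ∈ Finset.univ.erase i, K t (σ j) j) • K' (σ i) i) t :=
    HasDerivAt.fun_sum fun σ _ =>
      (HasDerivAt.fun_finsetProd fun i _ => h (σ i) i).const_mul _
  simp only [Matrix.det_apply']
  convert h1 using 1
  have h2 : ∀ i, ((K t).adjugate * K') i i =
      ∑ σ : Equiv.Perm ι, (Equiv.Perm.sign σ : ℝ) *
        ((∏ j ∈ Finset.univ.erase i, K t (σ j) j) * K' (σ i) i) := by
    intro i
    have h3 : ((K t).adjugate * K') i i = ((K t).adjugate.mulVec fun j => K' j i) i := rfl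
    rw [h3, ← Matrix.cramer_eq_adjugate_mulVec, Matrix.cramer_apply, Matrix.det_apply']
    refine Finset.sum_congr rfl fun σ _ => ?_
    rw [← Finset.prod_erase_mul _ _ (Finset.mem_univ i)]
    congr 2
    · refine Finset.prod_congr rfl fun j hj => ?_
      rw [Matrix.updateCol_ne (Finset.ne_of_mem_erase hj)]
    · rw [Matrix.updateCol_self]
  simp only [Matrix.trace, Matrix.diag, h2, smul_eq_mul, Finset.mul_sum]
  exact Finset.sum_comm

/-- Writing `P⁻¹` as a sum of rank-one matrices `v vᵀ` turns the trace into a sum of values `vᵀ U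
v`. It is applied with `U` the Hessian of the time function at a minimum. -/
theorem Matrix.PosDef.trace_inv_mul_nonneg {P U : Matrix ι ι ℝ} (hP : P.PosDef)
    (hU : ∀ v : ι → ℝ, 0 ≤ v ⬝ᵥ U.mulVec v) : 0 ≤ (P⁻¹ * U).trace := by
  obtain ⟨m, v, hv⟩ := Matrix.posSemidef_iff_eq_sum_vecMulVec.mp hP.inv.posSemidef
  rw [hv, Finset.sum_mul, Matrix.trace_sum]
  refine Finset.sum_nonneg fun i _ => ?_
  have : (Matrix.vecMulVec (v i) (star (v i)) * U).trace = v i ⬝ᵥ U.mulVec (v i) := by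
    rw [Matrix.vecMulVec_mul, Matrix.trace_vecMulVec, dotProduct_comm, Matrix.dotProduct_mulVec,
      star_trivial]
  rw [this]
  exact hU _

/-- By the matrix determinant lemma the right side is `det A * (1 + wᵀ A⁻¹ w)`. Here `A` will be the
induced metric and `w` the scaled differential of the time function. -/
theorem Matrix.PosDef.det_le_det_add_vecMulVec {A : Matrix ι ι ℝ} (hA : A.PosDef) (w : ι → ℝ) :
    A.det ≤ (A + Matrix.vecMulVec w w).det := by
  have h1 : A + Matrix.vecMulVec w w = A * (1 + A⁻¹ * Matrix.vecMulVec w w) := by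
    rw [mul_add, mul_one, Matrix.mul_nonsing_inv_cancel_left _ _
      ((Matrix.isUnit_iff_isUnit_det A).1 hA.isUnit)]
  have h2 : (1 + A⁻¹ * Matrix.vecMulVec w w).det = 1 + w ⬝ᵥ A⁻¹.mulVec w := by
    rw [Matrix.vecMulVec_eq Unit, ← Matrix.mul_assoc, Matrix.det_one_add_mul_comm]
    simp [Matrix.mul_apply, Matrix.mulVec, dotProduct, Finset.mul_sum]
  rw [h1, Matrix.det_mul, h2]
  have h3 := hA.inv.posSemidef.dotProduct_mulVec_nonneg w
  rw [star_trivial] at h3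
  nlinarith [hA.det_pos]

end MatrixLemmas

/-! ### Second-order conditions at a local minimum. -/

/-- A negative second derivative would make the point a local maximum too; the function would then
be locally constant, with second derivative zero. -/
theorem IsLocalMin.deriv_deriv_nonneg {f : ℝ → ℝ} {x : ℝ} (h : IsLocalMin f x)
    (hc : ContinuousAt f x) : 0 ≤ deriv (deriv f) x := by
  by_contra! hneg
  have hmax := isLocalMax_of_deriv_deriv_neg hneg h.deriv_eq_zero hc
  have h1 : f =ᶠ[𝓝 x] fun _ => f x := by
    filter_upwards [h, hmax] with y h1 h2 using le_antisymm h2 h1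
  have h2 := h1.deriv.deriv_eq
  simp at h2
  exact hneg.ne h2

/-- The Hessian of a function is non-negative at a local minimum. -/
theorem IsLocalMin.fderiv_fderiv_nonneg {E : Type*} [NormedAddCommGroup E] [NormedSpace ℝ E]
    {u : E → ℝ} {c : E} (h : IsLocalMin u c) (hu : ContDiffAt ℝ 2 u c) (v : E) :
    0 ≤ fderiv ℝ (fun η => fderiv ℝ u η v) c v := by
  -- Restricting `u` to the line through `c` in direction `v` reduces the claim to one variable.
  set l : ℝ → E := fun s => c + s • v with hl
  have hl0 : l 0 = c := by simp [hl]
  have hld : ∀ s, HasDerivAt l v s := fun s => by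
    have h1 := ((hasDerivAt_id s).smul_const v).const_add c
    rw [one_smul] at h1
    exact h1
  have hlc : Tendsto l (𝓝 0) (𝓝 c) := by
    have := (hld 0).continuousAt.tendsto
    rwa [hl0] at this
  have h1 : IsLocalMin (u ∘ l) 0 := by
    have := hlc.eventually h
    simpa [IsLocalMin, IsMinFilter, hl0] using this
  have hdiff : ∀ᶠ η in 𝓝 c, DifferentiableAt ℝ u η := by
    filter_upwards [hu.eventually (by simp)] with η hη using hη.differentiableAt (by simp)
  have h2 : deriv (u ∘ l) =ᶠ[𝓝 0] fun s => fderiv ℝ u (l s) v := by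
    filter_upwards [hlc.eventually hdiff] with s hs
    exact (hs.hasFDerivAt.comp_hasDerivAt s (hld s)).deriv
  have h3 : DifferentiableAt ℝ (fun η => fderiv ℝ u η v) c := by
    have : ContDiffAt ℝ 1 (fderiv ℝ u) c := hu.fderiv_right (by norm_num)
    exact (this.differentiableAt (by simp)).clm_apply (differentiableAt_const v)
  have h4 : deriv (deriv (u ∘ l)) 0 = fderiv ℝ (fun η => fderiv ℝ u η v) c v := by
    rw [h2.deriv_eq]
    have h5 := h3.hasFDerivAt
    rw [← hl0] at h5 ⊢
    exact (h5.comp_hasDerivAt (0 : ℝ) (hld 0)).deriv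
  rw [← h4]
  refine h1.deriv_deriv_nonneg ?_
  refine ContinuousAt.comp ?_ (hld 0).continuousAt
  rw [hl0]
  exact hu.continuousAt

theorem EuclideanSpace.map_eq_sum_single {n : ℕ} {F : Type*} [AddCommGroup F] [Module ℝ F]
    (L : Rn n →ₗ[ℝ] F) (v : Rn n) : L v = ∑ k, v k • L (EuclideanSpace.single k 1) := by
  conv_lhs => rw [← (EuclideanSpace.basisFun (Fin n) ℝ).sum_repr v]
  simp [map_sum]

/-! ### Frames, Gram determinants and the curvature of slices. -/

section Charts

variable {n : ℕ} {M : Type u} [TopologicalSpace M] [ChartedSpace (Rn n) M]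

/-- The linear map `w ↦ coordVec c y w`. -/
noncomputable def coordMap (c : OpenPartialHomeomorph M (Rn n)) (y : Rn n) :
    Rn n →L[ℝ] TangentSpace (𝓡 n) (c.symm y) :=
  mfderiv 𝓘(ℝ, Rn n) (𝓡 n) c.symm y

theorem coordMap_bijective [IsManifold (𝓡 n) 1 M] {c : OpenPartialHomeomorph M (Rn n)}
    (hc : c ∈ atlas (Rn n) M) {y : Rn n} (hy : y ∈ c.target) :
    Function.Bijective (coordMap c y) :=
  (mdifferentiable_of_mem_atlas (I := 𝓡 n) hc).symm.mfderiv_bijective hy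

end Charts

namespace GaussianSpacetime

variable {n : ℕ} {S : Type u} [TopologicalSpace S] [ChartedSpace (Rn n) S]

/-- The Gram matrix of the spatial part `e^{2ψ} σ` of the metric with respect to the frame
`L e₁, …, L eₙ`. -/
noncomputable def gram (N : GaussianSpacetime n S) (t : ℝ) (x : S)
    (L : Rn n →L[ℝ] TangentSpace (𝓡 n) x) : Matrix (Fin n) (Fin n) ℝ :=
  Matrix.of fun i j => Real.exp (2 * N.ψ t x) *
    N.σ t x (L (EuclideanSpace.single i 1)) (L (EuclideanSpace.single j 1))

theorem gram_apply (N : GaussianSpacetime n S) (t : ℝ) (x : S)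
    (L : Rn n →L[ℝ] TangentSpace (𝓡 n) x) (i j : Fin n) :
    N.gram t x L i j = Real.exp (2 * N.ψ t x) *
      N.σ t x (L (EuclideanSpace.single i 1)) (L (EuclideanSpace.single j 1)) := rfl

theorem dotProduct_gram_mulVec (N : GaussianSpacetime n S) (t : ℝ) (x : S)
    (L : Rn n →L[ℝ] TangentSpace (𝓡 n) x) (v w : Rn n) :
    (fun i => v i) ⬝ᵥ (N.gram t x L).mulVec (fun i => w i) =
      Real.exp (2 * N.ψ t x) * N.σ t x (L v) (L w) := by
  have h1 : L v = ∑ k, v k • L (EuclideanSpace.single k 1) :=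
    EuclideanSpace.map_eq_sum_single (L : Rn n →ₗ[ℝ] TangentSpace (𝓡 n) x) v
  have h2 : L w = ∑ k, w k • L (EuclideanSpace.single k 1) :=
    EuclideanSpace.map_eq_sum_single (L : Rn n →ₗ[ℝ] TangentSpace (𝓡 n) x) w
  rw [h1, h2]
  simp only [dotProduct, Matrix.mulVec, gram_apply, map_sum, sum_apply,
    map_smul, smul_apply, smul_eq_mul, Finset.mul_sum]
  rw [Finset.sum_comm]
  refine Finset.sum_congr rfl fun i _ => Finset.sum_congr rfl fun j _ => ?_
  ring

/-- If `P` is the matrix of `A` in the standard basis, the Gram matrix changes to `Pᵀ G P`. -/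
theorem det_gram_comp (N : GaussianSpacetime n S) (t : ℝ) (x : S)
    (L : Rn n →L[ℝ] TangentSpace (𝓡 n) x) (A : Rn n →L[ℝ] Rn n) :
    (N.gram t x (L.comp A)).det = A.det ^ 2 * (N.gram t x L).det := by
  set b := (EuclideanSpace.basisFun (Fin n) ℝ).toBasis
  set P := LinearMap.toMatrix b b (A : Rn n →ₗ[ℝ] Rn n) with hP
  have hPi : ∀ k i, P k i = A (EuclideanSpace.single i 1) k := fun k i => by
    simp [hP, b, LinearMap.toMatrix_apply]
  have h1 : N.gram t x (L.comp A) = P.transpose * N.gram t x L * P := by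
    ext i j
    have h2 : (P.transpose * N.gram t x L * P) i j =
        (fun k => A (EuclideanSpace.single i 1) k) ⬝ᵥ
          (N.gram t x L).mulVec (fun k => A (EuclideanSpace.single j 1) k) := by
      rw [Matrix.mul_assoc, Matrix.mul_apply]
      simp only [dotProduct, Matrix.transpose_apply, hPi, Matrix.mul_apply, Matrix.mulVec]
    rw [h2, dotProduct_gram_mulVec]
    rfl
  have h3 : A.det = P.det := (LinearMap.det_toMatrix b _).symm
  rw [h1, Matrix.det_mul, Matrix.det_mul, Matrix.det_transpose, h3]
  ring

theorem gram_posDef (N : GaussianSpacetime n S) {t : ℝ} (ht : t ∈ N.I) (x : S)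
    {L : Rn n →L[ℝ] TangentSpace (𝓡 n) x} (hL : Function.Injective L) :
    (N.gram t x L).PosDef := by
  refine Matrix.PosDef.of_dotProduct_mulVec_pos ?_ fun v hv => ?_
  · ext i j
    simp only [Matrix.conjTranspose_apply, star_trivial, gram_apply]
    rw [N.σ_symm t ht.1 ht.2]
  · have h1 := N.dotProduct_gram_mulVec t x L (WithLp.toLp 2 v) (WithLp.toLp 2 v)
    rw [star_trivial]
    have h2 : v ⬝ᵥ (N.gram t x L).mulVec v = _ := h1
    rw [h2]
    refine mul_pos (Real.exp_pos _) (N.σ_pos t ht.1 ht.2 x _ fun h0 => hv ?_)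
    have h3 : (WithLp.toLp 2 v : Rn n) = 0 := hL (h0.trans (map_zero L).symm)
    simpa using h3

theorem exists_eq_comp_of_bijective {x : S} {L : Rn n →L[ℝ] TangentSpace (𝓡 n) x}
    (hL : Function.Bijective L) (L' : Rn n →L[ℝ] TangentSpace (𝓡 n) x) :
    ∃ A : Rn n →L[ℝ] Rn n, L' = L.comp A := by
  let e : Rn n ≃ₗ[ℝ] TangentSpace (𝓡 n) x :=
    LinearEquiv.ofBijective (L : Rn n →ₗ[ℝ] TangentSpace (𝓡 n) x) hL
  refine ⟨LinearMap.toContinuousLinearMap (e.symm.toLinearMap ∘ₗ (L' : _ →ₗ[ℝ] _)), ?_⟩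
  ext1 v
  exact (e.apply_symm_apply (L' v)).symm

/-- The mean curvature of the slice `{x⁰ = t}` at `x`, written as a logarithmic derivative of the
volume density with respect to any frame. -/
noncomputable def sliceCurvature (N : GaussianSpacetime n S) (t : ℝ) (x : S)
    (L : Rn n →L[ℝ] TangentSpace (𝓡 n) x) : ℝ :=
  -(Real.exp (-N.ψ t x) / 2 * (deriv (fun s => (N.gram s x L).det) t / (N.gram t x L).det))

/-- A change of frame multiplies the determinant by the time-independent factor `(det A)²`, which
cancels in the logarithmic derivative. -/
theorem sliceCurvature_congr (N : GaussianSpacetime n S) (t : ℝ) {x : S}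
    {L L' : Rn n →L[ℝ] TangentSpace (𝓡 n) x} (hL : Function.Bijective L)
    (hL' : Function.Bijective L') : N.sliceCurvature t x L' = N.sliceCurvature t x L := by
  obtain ⟨A, rfl⟩ := exists_eq_comp_of_bijective hL L'
  have hA : A.det ≠ 0 := by
    have h1 : Function.Injective A := Function.Injective.of_comp hL'.1
    exact (LinearEquiv.ofInjectiveEndo (A : Rn n →ₗ[ℝ] Rn n) h1).isUnit_det'.ne_zero
  have hA2 : A.det ^ 2 ≠ 0 := pow_ne_zero 2 hA
  simp only [sliceCurvature, det_gram_comp, deriv_const_mul_field']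
  rw [mul_div_mul_left _ _ hA2]

/-- The domain of the coordinates `(x⁰, c)`. -/
def coordDomain (N : GaussianSpacetime n S) (c : OpenPartialHomeomorph S (Rn n)) :
    Set (ℝ × Rn n) :=
  {z | (N.a < z.1 ∧ z.1 < N.b) ∧ z.2 ∈ c.target}

theorem isOpen_I (N : GaussianSpacetime n S) : IsOpen N.I :=
  (isOpen_lt continuous_const continuous_coe_real_ereal).inter
    (isOpen_lt continuous_coe_real_ereal continuous_const)

theorem isOpen_coordDomain (N : GaussianSpacetime n S) (c : OpenPartialHomeomorph S (Rn n)) :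
    IsOpen (N.coordDomain c) :=
  (N.isOpen_I.preimage continuous_fst).inter (c.open_target.preimage continuous_snd)

theorem I_ordConnected (N : GaussianSpacetime n S) : N.I.OrdConnected :=
  ⟨fun _ hs _ ht _ hr =>
    ⟨hs.1.trans_le (EReal.coe_le_coe_iff.2 hr.1), (EReal.coe_le_coe_iff.2 hr.2).trans_lt ht.2⟩⟩

variable [IsManifold (𝓡 n) ∞ S]

theorem contDiffOn_ψ_symm (N : GaussianSpacetime n S) {c : OpenPartialHomeomorph S (Rn n)}
    (hc : c ∈ atlas (Rn n) S) :
    ContDiffOn ℝ ∞ (fun z : ℝ × Rn n => N.ψ z.1 (c.symm z.2)) (N.coordDomain c) := by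
  rw [← contMDiffOn_iff_contDiffOn]
  have h1 : ContMDiffOn 𝓘(ℝ, ℝ × Rn n) (𝓘(ℝ, ℝ).prod (𝓡 n)) ∞
      (fun z : ℝ × Rn n => (z.1, c.symm z.2)) (N.coordDomain c) := by
    refine ContMDiffOn.prodMk contDiff_fst.contMDiff.contMDiffOn ?_
    exact (contMDiffOn_symm_of_mem_maximalAtlas (n := ∞) (IsManifold.subset_maximalAtlas hc)).comp
      contDiff_snd.contMDiff.contMDiffOn fun z hz => hz.2
  exact N.ψ_smooth.comp h1 fun z hz => hz.1

/-- The components of the spatial part of the metric are smooth. -/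
theorem contDiffOn_spatial (N : GaussianSpacetime n S) {c : OpenPartialHomeomorph S (Rn n)}
    (hc : c ∈ atlas (Rn n) S) (v w : Rn n) :
    ContDiffOn ℝ ∞ (fun z : ℝ × Rn n => Real.exp (2 * N.ψ z.1 (c.symm z.2)) *
      N.σ z.1 (c.symm z.2) (coordVec c z.2 v) (coordVec c z.2 w)) (N.coordDomain c) :=
  (contDiffOn_const.mul (N.contDiffOn_ψ_symm hc)).exp.mul (N.σ_smooth c hc v w)

theorem contDiffOn_det_gram (N : GaussianSpacetime n S) {c : OpenPartialHomeomorph S (Rn n)}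
    (hc : c ∈ atlas (Rn n) S) :
    ContDiffOn ℝ ∞ (fun z : ℝ × Rn n => (N.gram z.1 (c.symm z.2) (coordMap c z.2)).det)
      (N.coordDomain c) := by
  simp only [Matrix.det_apply']
  refine ContDiffOn.sum fun τ _ => contDiffOn_const.mul (contDiffOn_prod fun i _ => ?_)
  exact N.contDiffOn_spatial hc _ _

/-- Smoothness of `σ` is given only for chart components, so the fixed vectors `v`, `w` are first
written as coordinate vectors at the fixed point `y`. -/
theorem differentiableAt_spatial (N : GaussianSpacetime n S) {t : ℝ} (ht : t ∈ N.I) {x : S}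
    (v w : TangentSpace (𝓡 n) x) :
    DifferentiableAt ℝ (fun s => Real.exp (2 * N.ψ s x) * N.σ s x v w) t := by
  obtain ⟨c, hc, y, hy, rfl⟩ : ∃ c ∈ atlas (Rn n) S, ∃ y ∈ c.target, c.symm y = x :=
    ⟨chartAt (Rn n) x, chart_mem_atlas _ _, chartAt (Rn n) x x,
      mem_chart_target _ _, (chartAt (Rn n) x).left_inv (mem_chart_source _ _)⟩
  obtain ⟨v, rfl⟩ := (coordMap_bijective hc hy).2 v
  obtain ⟨w, rfl⟩ := (coordMap_bijective hc hy).2 w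
  have h1 : DifferentiableAt ℝ (fun z : ℝ × Rn n => Real.exp (2 * N.ψ z.1 (c.symm z.2)) *
      N.σ z.1 (c.symm z.2) (coordVec c z.2 v) (coordVec c z.2 w)) (t, y) :=
    ((N.contDiffOn_spatial hc v w).contDiffAt
      ((N.isOpen_coordDomain c).mem_nhds (show (t, y) ∈ _ from ⟨ht, hy⟩))).differentiableAt
      (by simp)
  exact (h1.hasFDerivAt.comp_hasDerivAt t
    ((hasDerivAt_id t).prodMk (hasDerivAt_const t y))).differentiableAt

theorem differentiableAt_gram (N : GaussianSpacetime n S) {t : ℝ} (ht : t ∈ N.I) {x : S}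
    (L : Rn n →L[ℝ] TangentSpace (𝓡 n) x) (i j : Fin n) :
    DifferentiableAt ℝ (fun s => N.gram s x L i j) t :=
  N.differentiableAt_spatial ht _ _

theorem hasDerivAt_det_gram (N : GaussianSpacetime n S) {t : ℝ} (ht : t ∈ N.I) {x : S}
    (L : Rn n →L[ℝ] TangentSpace (𝓡 n) x) :
    HasDerivAt (fun s => (N.gram s x L).det)
      ((N.gram t x L).adjugate *
        Matrix.of fun i j => deriv (fun s => N.gram s x L i j) t).trace t :=
  Matrix.hasDerivAt_det fun i j => (N.differentiableAt_gram ht L i j).hasDerivAt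

theorem sliceCurvature_eq_trace (N : GaussianSpacetime n S) {t : ℝ} (ht : t ∈ N.I) {x : S}
    {L : Rn n →L[ℝ] TangentSpace (𝓡 n) x} :
    N.sliceCurvature t x L = -(Real.exp (-N.ψ t x) / 2 * ((N.gram t x L)⁻¹ *
      Matrix.of fun i j => deriv (fun s => N.gram s x L i j) t).trace) := by
  rw [sliceCurvature, (N.hasDerivAt_det_gram ht L).deriv, Matrix.inv_def, Matrix.smul_mul,
    Matrix.trace_smul, Ring.inverse_eq_inv', smul_eq_mul, div_eq_inv_mul (Matrix.trace _)]

/-- Since the determinant is positive, non-negative slice curvature forces its time derivative to be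
non-positive. -/
theorem det_gram_antitone (N : GaussianSpacetime n S) {s t : ℝ} (hs : s ∈ N.I) (ht : t ∈ N.I)
    (hst : s ≤ t) {x : S} {L : Rn n →L[ℝ] TangentSpace (𝓡 n) x} (hL : Function.Bijective L)
    (h : ∀ r ∈ Icc s t, 0 ≤ N.sliceCurvature r x L) :
    (N.gram t x L).det ≤ (N.gram s x L).det := by
  have hI : ∀ r ∈ Icc s t, r ∈ N.I := fun r hr => N.I_ordConnected.out hs ht hr
  have h1 : AntitoneOn (fun r => (N.gram r x L).det) (Icc s t) := by
    refine antitoneOn_of_deriv_nonpos (convex_Icc s t)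
      (fun r hr => (N.hasDerivAt_det_gram (hI r hr) L).continuousAt.continuousWithinAt)
      (fun r hr => (N.hasDerivAt_det_gram
        (hI r (interior_subset hr)) L).differentiableAt.differentiableWithinAt) fun r hr => ?_
    have hr := interior_subset hr
    have h2 := h r hr
    rw [sliceCurvature] at h2
    have h3 := (N.gram_posDef (hI r hr) x hL.1).det_pos
    by_contra! h4
    have := mul_pos (half_pos (Real.exp_pos (-N.ψ r x))) (div_pos h4 h3)
    linarith
  exact h1 (left_mem_Icc.2 hst) (right_mem_Icc.2 hst) hst

/-- The mean curvature of slices is bounded on compact time intervals. -/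
theorem exists_sliceCurvature_le [CompactSpace S] (N : GaussianSpacetime n S) {s t : ℝ}
    (hs : s ∈ N.I) (ht : t ∈ N.I) :
    ∃ C, ∀ r ∈ Icc s t, ∀ (x : S) (L : Rn n →L[ℝ] TangentSpace (𝓡 n) x), Function.Bijective L →
      N.sliceCurvature r x L ≤ C := by
  -- Each tangent space is definitionally `Rn n`, so the identity serves as a frame at every point.
  -- It need not vary continuously with the point, but by frame independence `F` agrees near any
  -- point with the expression `G` in a chart frame, which is continuous.
  let F : ℝ × S → ℝ := fun p => N.sliceCurvature p.1 p.2
    (ContinuousLinearMap.id ℝ (Rn n) : Rn n →L[ℝ] TangentSpace (𝓡 n) p.2)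
  have hid : ∀ x : S, Function.Bijective
      (ContinuousLinearMap.id ℝ (Rn n) : Rn n →L[ℝ] TangentSpace (𝓡 n) x) :=
    fun x => Function.bijective_id
  have hF : ContinuousOn F (Icc s t ×ˢ univ) := by
    rintro ⟨r, x⟩ ⟨hr, -⟩
    have hr : r ∈ N.I := N.I_ordConnected.out hs ht hr
    refine ContinuousAt.continuousWithinAt ?_
    set c := chartAt (Rn n) x with hc
    have hca : c ∈ atlas (Rn n) S := chart_mem_atlas _ _
    let G : ℝ × Rn n → ℝ := fun z => N.sliceCurvature z.1 (c.symm z.2) (coordMap c z.2)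
    have hz : (r, c x) ∈ N.coordDomain c := ⟨hr, mem_chart_target _ _⟩
    have hnhds := (N.isOpen_coordDomain c).mem_nhds hz
    have hG : ContinuousAt G (r, c x) := by
      have hD := (N.contDiffOn_det_gram hca).contDiffAt hnhds
      have hψ := ((N.contDiffOn_ψ_symm hca).contDiffAt hnhds).continuousAt
      have hd : ContinuousAt (fun z : ℝ × Rn n =>
          deriv (fun s => (N.gram s (c.symm z.2) (coordMap c z.2)).det) z.1) (r, c x) := by
        have h1 : ContDiffAt ℝ 0 (fderiv ℝ fun z : ℝ × Rn n =>
            (N.gram z.1 (c.symm z.2) (coordMap c z.2)).det) (r, c x) :=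
          hD.fderiv_right (by simp)
        -- The time derivative is the full derivative applied to `(1, 0)`.
        have h2 := h1.continuousAt.clm_apply (continuousAt_const (y := ((1 : ℝ), (0 : Rn n))))
        refine h2.congr ?_
        filter_upwards [hnhds] with z hz
        have h3 := ((N.contDiffOn_det_gram hca).contDiffAt
          ((N.isOpen_coordDomain c).mem_nhds hz)).differentiableAt (by simp)
        exact (HasFDerivAt.comp_hasDerivAt z.1 h3.hasFDerivAt
          ((hasDerivAt_id z.1).prodMk (hasDerivAt_const z.1 z.2))).deriv.symm
      refine (((hψ.neg.rexp).div_const 2).mul (hd.div hD.continuousAt ?_)).neg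
      exact (N.gram_posDef hr _ (coordMap_bijective hca hz.2).1).det_pos.ne'
    have hcomp : ContinuousAt (fun p : ℝ × S => G (p.1, c p.2)) (r, x) := by
      refine ContinuousAt.comp (g := G) hG (continuousAt_fst.prodMk ?_)
      exact (c.continuousAt (mem_chart_source _ _)).comp continuousAt_snd
    refine hcomp.congr ?_
    have h1 : {p : ℝ × S | p.1 ∈ N.I ∧ p.2 ∈ c.source} ∈ 𝓝 (r, x) :=
      ((N.isOpen_I.preimage continuous_fst).inter
        (c.open_source.preimage continuous_snd)).mem_nhds ⟨hr, mem_chart_source _ _⟩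
    filter_upwards [h1] with p hp
    obtain ⟨q, x'⟩ := p
    obtain ⟨y, hy, rfl⟩ : ∃ y ∈ c.target, c.symm y = x' :=
      ⟨c x', c.map_source hp.2, c.left_inv hp.2⟩
    simp only [G, F, c.right_inv hy]
    exact N.sliceCurvature_congr q (hid (c.symm y)) (coordMap_bijective hca hy)
  obtain ⟨C, hC⟩ := (isCompact_Icc.prod isCompact_univ).bddAbove_image hF
  refine ⟨C, fun r hr x L hL => ?_⟩
  rw [N.sliceCurvature_congr r (hid x) hL]
  exact hC (mem_image_of_mem F (x := (r, x)) ⟨hr, mem_univ _⟩)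

end GaussianSpacetime

/-! ### Injectivity of local homeomorphisms with a height function. -/

/-- A local homeomorphism from a compact connected space is injective if its fibres are separated
by a continuous real function. -/
theorem IsLocalHomeomorph.injective_of_height {X Y : Type*} [TopologicalSpace X]
    [TopologicalSpace Y] [CompactSpace X] [ConnectedSpace X] [T2Space Y] {p : X → Y}
    (hp : IsLocalHomeomorph p) {τ : X → ℝ} (hτ : Continuous τ)
    (hinj : Function.Injective fun ξ => (τ ξ, p ξ)) : Function.Injective p := by
  -- `B` consists of the points that are not highest in their fibre. It is shown to be open and
  -- closed, hence empty or everything.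
  let B : Set X := {ξ | ∃ η, p η = p ξ ∧ τ ξ < τ η}
  have hopen : IsOpen B := by
    rw [isOpen_iff_mem_nhds]
    rintro ξ ⟨η, h1, h2⟩
    -- A level `m` strictly between the two heights leaves room to perturb: `p` is open, so nearby
    -- fibres still meet the region above `m`, while points near `ξ` stay below it.
    obtain ⟨m, hm1, hm2⟩ := exists_between h2
    have h3 : p '' {η' | m < τ η'} ∈ 𝓝 (p ξ) := by
      rw [← h1]
      exact hp.isOpenMap.image_mem_nhds ((isOpen_lt continuous_const hτ).mem_nhds hm2)
    filter_upwards [hp.continuous.continuousAt h3, (isOpen_lt hτ continuous_const).mem_nhds hm1]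
      with ξ' h4 h5
    obtain ⟨η', h6, h7⟩ := h4
    exact ⟨η', h7, lt_trans h5 h6⟩
  have hclosed : IsClosed B := by
    -- Closedness of `R` uses local injectivity of `p` near the diagonal. With `≤` in place of `<`
    -- the condition is closed, and `hinj` makes it strict again off the diagonal.
    let R : Set (X × X) := {q | q.1 ≠ q.2 ∧ p q.2 = p q.1 ∧ τ q.1 ≤ τ q.2}
    have hR : IsClosed R := by
      have h1 : IsClosed {q : X × X | p q.2 = p q.1 ∧ τ q.1 ≤ τ q.2} :=
        (isClosed_eq (hp.continuous.comp continuous_snd) (hp.continuous.comp continuous_fst)).inter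
          (isClosed_le (hτ.comp continuous_fst) (hτ.comp continuous_snd))
      rw [← isOpen_compl_iff, isOpen_iff_mem_nhds]
      rintro ⟨ξ, η⟩ hq
      by_cases h2 : ξ = η
      · subst h2
        obtain ⟨e, he, rfl⟩ := hp ξ
        filter_upwards [(e.open_source.prod e.open_source).mem_nhds
          (show (ξ, ξ) ∈ _ from ⟨he, he⟩)] with q h3 h4
        exact h4.1 (e.injOn h3.1 h3.2 h4.2.1.symm)
      · filter_upwards [h1.isOpen_compl.mem_nhds fun h3 => hq ⟨h2, h3⟩] with q h3 h4
        exact h3 h4.2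
    have hB : B = Prod.fst '' R := by
      ext ξ
      constructor
      · rintro ⟨η, h1, h2⟩
        exact ⟨(ξ, η), ⟨fun h => h2.ne (congrArg τ h), h1, h2.le⟩, rfl⟩
      · rintro ⟨⟨ξ, η⟩, ⟨h1, h2, h3⟩, rfl⟩
        exact ⟨η, h2, h3.lt_of_ne fun h => h1 (hinj (Prod.ext h h2.symm))⟩
    rw [hB]
    exact isClosedMap_fst_of_compactSpace _ hR
  have hempty : B = ∅ := by
    rcases isClopen_iff.1 ⟨hclosed, hopen⟩ with h | h
    · exact h
    -- A global maximum of the height cannot belong to `B`.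
    · obtain ⟨ξ, -, hξ⟩ := isCompact_univ.exists_isMaxOn univ_nonempty hτ.continuousOn
      obtain ⟨η, -, h2⟩ := h.ge (mem_univ ξ)
      exact absurd (hξ (mem_univ η)) (not_le.2 h2)
  have hle : ∀ ξ η, p η = p ξ → τ η ≤ τ ξ := fun ξ η h => by
    by_contra! h2
    exact hempty.le (⟨η, h, h2⟩ : ξ ∈ B)
  exact fun ξ η h => hinj (Prod.ext (le_antisymm (hle _ _ h) (hle _ _ h.symm)) h)

/-! ### Volume sums and finite Borel partitions into chart domains. -/

section Volume

variable {n : ℕ} {M : Type u} [TopologicalSpace M] [ChartedSpace (Rn n) M]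

theorem sum_le_riemVolume {ι : Type*} [Fintype ι]
    (g : ∀ x : M, TangentSpace (𝓡 n) x → TangentSpace (𝓡 n) x → ℝ)
    (c : ι → OpenPartialHomeomorph M (Rn n)) (A : ι → Set M)
    (h : ∀ i, c i ∈ atlas (Rn n) M ∧ MeasurableSet[borel M] (A i) ∧ A i ⊆ (c i).source)
    (hd : Pairwise fun i j => Disjoint (A i) (A j)) :
    ∑ i, ∫⁻ y in c i '' A i, ENNReal.ofReal (volDensity g (c i) y) ≤ riemVolume g := by
  let e := Fintype.equivFin ι
  rw [← e.symm.sum_comp]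
  refine le_iSup_of_le (Fintype.card ι) (le_iSup_of_le (c ∘ e.symm) (le_iSup_of_le (A ∘ e.symm)
    (le_iSup_of_le ⟨fun i => h _, fun i j hij => hd (e.symm.injective.ne hij)⟩ le_rfl)))

theorem OpenPartialHomeomorph.measurableSet_image {X Y : Type*} [TopologicalSpace X]
    [TopologicalSpace Y] [MeasurableSpace X] [BorelSpace X] [MeasurableSpace Y] [BorelSpace Y]
    (c : OpenPartialHomeomorph X Y) {A : Set X} (hA : MeasurableSet A) (hAc : A ⊆ c.source) :
    MeasurableSet (c '' A) := by
  have h1 : c '' A = Subtype.val '' (c.target.domRestrict c.symm ⁻¹' A) := by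
    rw [c.image_eq_target_inter_inv_preimage hAc, domRestrict_eq, preimage_comp,
      Subtype.image_preimage_coe]
  rw [h1]
  exact c.open_target.measurableSet.subtype_image
    (c.continuousOn_symm.domRestrict.measurable hA)

theorem exists_finite_measurable_partition [CompactSpace M] :
    ∃ (k : ℕ) (d : Fin k → OpenPartialHomeomorph M (Rn n)) (B : Fin k → Set M),
      (∀ j, d j ∈ atlas (Rn n) M ∧ MeasurableSet[borel M] (B j) ∧ B j ⊆ (d j).source) ∧
      (Pairwise fun i j => Disjoint (B i) (B j)) ∧ ⋃ j, B j = univ := by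
  obtain ⟨t, ht⟩ := CompactSpace.elim_nhds_subcover (fun x : M => (chartAt (Rn n) x).source)
    fun x => (chartAt (Rn n) x).open_source.mem_nhds (mem_chart_source _ x)
  let d : Fin t.card → OpenPartialHomeomorph M (Rn n) :=
    fun j => chartAt (Rn n) (t.equivFin.symm j : M)
  have hcover : ∀ x, ∃ j, x ∈ (d j).source := fun x => by
    have hx := ht.ge (mem_univ x)
    simp only [mem_iUnion] at hx
    obtain ⟨z, hz, hx⟩ := hx
    exact ⟨t.equivFin ⟨z, hz⟩, by simpa [d] using hx⟩
  refine ⟨t.card, d, disjointed fun j => (d j).source, fun j => ⟨chart_mem_atlas _ _, ?_,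
    disjointed_le _ j⟩, disjoint_disjointed _, ?_⟩
  · borelize M
    exact disjointedRec (p := MeasurableSet) (fun _ _ hs => hs.diff (d _).open_source.measurableSet)
      (d j).open_source.measurableSet
  · rw [iUnion_disjointed]
    exact eq_univ_of_forall fun x => mem_iUnion.2 (hcover x)

end Volume

/-! ### Induced metric and projection of a spacelike hypersurface. -/

namespace GaussianSpacetime

variable {n : ℕ} {S : Type u} [TopologicalSpace S] [ChartedSpace (Rn n) S]

/-- The metric `e^{2ψ} σ` of the slice `{x⁰ = t}`. -/
noncomputable def spatialMetric (N : GaussianSpacetime n S) (t : ℝ) (x : S)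
    (v w : TangentSpace (𝓡 n) x) : ℝ :=
  Real.exp (2 * N.ψ t x) * N.σ t x v w

theorem volDensity_spatialMetric (N : GaussianSpacetime n S) (t : ℝ)
    (d : OpenPartialHomeomorph S (Rn n)) (z : Rn n) :
    volDensity (N.spatialMetric t) d z = √(N.gram t (d.symm z) (coordMap d z)).det := rfl

theorem volume_slice [IsManifold (𝓡 n) ∞ S] [CompactSpace S] [ConnectedSpace S]
    (N : GaussianSpacetime n S) (t : N.I) :
    (N.slice t).volume = riemVolume (N.spatialMetric t) := by
  have h : (fun (x : S) (v w : TangentSpace (𝓡 n) x) => (N.slice t).inducedMetric x v w) =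
      N.spatialMetric t := by
    funext x v w
    have h1 : mfderiv (𝓡 n) 𝓘(ℝ, ℝ) (fun _ : S => (t : ℝ)) x = 0 := mfderiv_const
    have h2 : mfderiv (𝓡 n) (𝓡 n) (fun y : S => y) x = ContinuousLinearMap.id ℝ _ := mfderiv_id
    change N.metric t x
      (mfderiv (𝓡 n) 𝓘(ℝ, ℝ) (fun _ : S => (t : ℝ)) x v, mfderiv (𝓡 n) (𝓡 n) (fun y : S => y) x v)
      (mfderiv (𝓡 n) 𝓘(ℝ, ℝ) (fun _ : S => (t : ℝ)) x w,
        mfderiv (𝓡 n) (𝓡 n) (fun y : S => y) x w) = _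
    rw [h1, h2]
    change Real.exp (2 * N.ψ t x) * (-((0 : ℝ) * 0) + N.σ t x v w) = _
    rw [mul_zero, neg_zero, zero_add]
    rfl
  exact congrArg (riemVolume (M := S)) h

namespace SpacelikeHypersurface

variable {N : GaussianSpacetime n S} {m : WithTop ℕ∞}

/-- The derivative of the projection to `S`. -/
noncomputable def projDeriv (M : SpacelikeHypersurface.{u, v} N m) (ξ : M.carrier) :
    TangentSpace (𝓡 n) ξ →L[ℝ] TangentSpace (𝓡 n) (M.proj ξ) :=
  mfderiv (𝓡 n) (𝓡 n) M.proj ξ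

/-- The derivative of the time function. -/
noncomputable def timeDeriv (M : SpacelikeHypersurface.{u, v} N m) (ξ : M.carrier) :
    TangentSpace (𝓡 n) ξ →L[ℝ] ℝ :=
  mfderiv (𝓡 n) 𝓘(ℝ, ℝ) M.time ξ

theorem inducedMetric_eq (M : SpacelikeHypersurface.{u, v} N m) (ξ : M.carrier)
    (v w : TangentSpace (𝓡 n) ξ) :
    M.inducedMetric ξ v w = Real.exp (2 * N.ψ (M.time ξ) (M.proj ξ)) *
      (-(M.timeDeriv ξ v * M.timeDeriv ξ w) +
        N.σ (M.time ξ) (M.proj ξ) (M.projDeriv ξ v) (M.projDeriv ξ w)) := rfl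

theorem inducedMetric_pos (M : SpacelikeHypersurface.{u, v} N m) (ξ : M.carrier)
    {v : TangentSpace (𝓡 n) ξ} (hv : v ≠ 0) : 0 < M.inducedMetric ξ v v := M.spacelike ξ v hv

/-- A vector killed by the projection is purely temporal, so its induced square length is at most
zero. -/
theorem projDeriv_injective (M : SpacelikeHypersurface.{u, v} N m) (ξ : M.carrier) :
    Function.Injective (M.projDeriv ξ) := by
  refine (injective_iff_map_eq_zero _).2 fun v hv => ?_
  by_contra hne
  have h := M.inducedMetric_pos ξ hne
  rw [inducedMetric_eq, hv, map_zero, add_zero] at h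
  nlinarith [Real.exp_pos (2 * N.ψ (M.time ξ) (M.proj ξ)), mul_self_nonneg (M.timeDeriv ξ v),
    mul_nonneg (Real.exp_pos (2 * N.ψ (M.time ξ) (M.proj ξ))).le
      (mul_self_nonneg (M.timeDeriv ξ v))]

theorem projDeriv_bijective (M : SpacelikeHypersurface.{u, v} N m) (ξ : M.carrier) :
    Function.Bijective (M.projDeriv ξ) := by
  let f : Rn n →ₗ[ℝ] Rn n :=
    { toFun := M.projDeriv ξ
      map_add' := map_add (M.projDeriv ξ)
      map_smul' := map_smul (M.projDeriv ξ) }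
  exact ⟨M.projDeriv_injective ξ,
    LinearMap.surjective_of_injective (f := f) (M.projDeriv_injective ξ)⟩

/-- The volume density is at most that of the projection to `S`, because the time component of the
metric is negative. -/
theorem volDensity_inducedMetric_le (M : SpacelikeHypersurface.{u, v} N m)
    [IsManifold (𝓡 n) 1 M.carrier] {c : OpenPartialHomeomorph M.carrier (Rn n)}
    (hc : c ∈ atlas (Rn n) M.carrier) {y : Rn n} (hy : y ∈ c.target) :
    volDensity M.inducedMetric c y ≤ √(N.gram (M.time (c.symm y)) (M.proj (c.symm y))
      ((M.projDeriv (c.symm y)).comp (coordMap c y))).det := by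
  set ξ := c.symm y with hξ
  set E := Real.exp (N.ψ (M.time ξ) (M.proj ξ)) with hE
  have hE2 : Real.exp (2 * N.ψ (M.time ξ) (M.proj ξ)) = E * E := by
    rw [hE, ← Real.exp_add, two_mul]
  let τ : Rn n →L[ℝ] ℝ := (M.timeDeriv ξ).comp (coordMap c y)
  let L : Rn n →L[ℝ] TangentSpace (𝓡 n) (M.proj ξ) := (M.projDeriv ξ).comp (coordMap c y)
  let G : Matrix (Fin n) (Fin n) ℝ := Matrix.of fun i j =>
    M.inducedMetric ξ (coordMap c y (EuclideanSpace.single i 1))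
      (coordMap c y (EuclideanSpace.single j 1))
  -- The factor `E = e^ψ` absorbs the conformal factor, so that the spatial Gram matrix exceeds the
  -- induced one by exactly `w wᵀ`.
  let w : Fin n → ℝ := fun i => E * τ (EuclideanSpace.single i 1)
  have hsum : N.gram (M.time ξ) (M.proj ξ) L = G + Matrix.vecMulVec w w := by
    ext i j
    simp only [Matrix.add_apply, Matrix.vecMulVec_apply, gram_apply, G, Matrix.of_apply,
      inducedMetric_eq, hE2, w, τ, L, ContinuousLinearMap.comp_apply]
    ring
  have hG : G.PosDef := by
    refine Matrix.PosDef.of_dotProduct_mulVec_pos ?_ fun v hv => ?_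
    · ext i j
      simp only [Matrix.conjTranspose_apply, star_trivial, G, Matrix.of_apply, inducedMetric_eq]
      rw [N.σ_symm _ (M.time_mem ξ).1 (M.time_mem ξ).2, mul_comm (M.timeDeriv ξ _)]
    · let V : Rn n := WithLp.toLp 2 v
      have h1 := N.dotProduct_gram_mulVec (M.time ξ) (M.proj ξ) L V V
      have h2 : G = N.gram (M.time ξ) (M.proj ξ) L - Matrix.vecMulVec w w := by
        rw [hsum, add_sub_cancel_right]
      have h3 : v ⬝ᵥ w = E * τ V := by
        have h4 : τ V = ∑ k, V k • τ (EuclideanSpace.single k 1) :=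
          EuclideanSpace.map_eq_sum_single (τ : Rn n →ₗ[ℝ] ℝ) V
        rw [h4, Finset.mul_sum]
        refine Finset.sum_congr rfl fun i _ => ?_
        simp only [w, V, smul_eq_mul]
        ring
      have h5 : v ⬝ᵥ (Matrix.vecMulVec w w).mulVec v = (v ⬝ᵥ w) * (v ⬝ᵥ w) := by
        rw [Matrix.vecMulVec_mulVec, dotProduct_smul, dotProduct_comm w v]
        rfl
      rw [star_trivial, h2, Matrix.sub_mulVec, dotProduct_sub, h5, h3]
      have h6 : v ⬝ᵥ (N.gram (M.time ξ) (M.proj ξ) L).mulVec v = _ := h1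
      rw [h6]
      have h7 : coordMap c y V ≠ 0 := fun h0 => hv <| by
        have h8 : V = 0 := (coordMap_bijective hc hy).1 (h0.trans (map_zero _).symm)
        simpa [V] using h8
      have h8 := M.inducedMetric_pos ξ h7
      rw [inducedMetric_eq, hE2] at h8
      rw [hE2]
      simp only [τ, L, ContinuousLinearMap.comp_apply]
      linarith
  refine Real.sqrt_le_sqrt ?_
  change G.det ≤ (N.gram (M.time ξ) (M.proj ξ) L).det
  rw [hsum]
  exact hG.det_le_det_add_vecMulVec w

theorem contDiffAt_time_symm (M : SpacelikeHypersurface.{u, v} N m)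
    {c : OpenPartialHomeomorph M.carrier (Rn n)} (hc : c ∈ atlas (Rn n) M.carrier) {y : Rn n}
    (hy : y ∈ c.target) : ContDiffAt ℝ m (fun η => M.time (c.symm η)) y := by
  rw [← contMDiffAt_iff_contDiffAt]
  have h1 : ContMDiffAt (𝓡 n) (𝓡 n) m c.symm y :=
    contMDiffAt_symm_of_mem_maximalAtlas (IsManifold.subset_maximalAtlas hc) hy
  exact (M.contMDiff_time _).comp y h1

variable [IsManifold (𝓡 n) ∞ S]

theorem contDiffAt_chart_proj_symm (M : SpacelikeHypersurface.{u, v} N m)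
    {c : OpenPartialHomeomorph M.carrier (Rn n)} (hc : c ∈ atlas (Rn n) M.carrier)
    {d : OpenPartialHomeomorph S (Rn n)} (hd : d ∈ atlas (Rn n) S) {k : WithTop ℕ∞}
    (hk : k ≤ m) (hk' : k ≤ (∞ : ℕ∞ω)) {y : Rn n}
    (hy : y ∈ c.target) (hyd : M.proj (c.symm y) ∈ d.source) :
    ContDiffAt ℝ k (fun η => d (M.proj (c.symm η))) y := by
  rw [← contMDiffAt_iff_contDiffAt]
  have h1 : ContMDiffAt (𝓡 n) (𝓡 n) m c.symm y :=
    contMDiffAt_symm_of_mem_maximalAtlas (IsManifold.subset_maximalAtlas hc) hy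
  have h2 : ContMDiffAt (𝓡 n) (𝓡 n) ∞ d (M.proj (c.symm y)) :=
    contMDiffAt_of_mem_maximalAtlas (IsManifold.subset_maximalAtlas hd) hyd
  exact ((h2.of_le hk').comp (c.symm y) ((M.contMDiff_proj _).of_le hk)).comp y (h1.of_le hk)

theorem fderiv_chart_proj_symm (M : SpacelikeHypersurface.{u, v} N m) (hm : 1 ≤ m)
    {c : OpenPartialHomeomorph M.carrier (Rn n)} (hc : c ∈ atlas (Rn n) M.carrier)
    {d : OpenPartialHomeomorph S (Rn n)} (hd : d ∈ atlas (Rn n) S) {y : Rn n}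
    (hy : y ∈ c.target) (hyd : M.proj (c.symm y) ∈ d.source) :
    fderiv ℝ (fun η => d (M.proj (c.symm η))) y =
      (mfderiv (𝓡 n) (𝓡 n) d (M.proj (c.symm y))).comp
        ((M.projDeriv (c.symm y)).comp (coordMap c y)) := by
  have : IsManifold (𝓡 n) 1 M.carrier := .of_le hm
  rw [← mfderiv_eq_fderiv]
  have h1 := ((mdifferentiable_of_mem_atlas (I := 𝓡 n) hc).mdifferentiableAt_symm hy).hasMFDerivAt
  have h2 := ((mdifferentiable_of_mem_atlas (I := 𝓡 n) hd).mdifferentiableAt hyd).hasMFDerivAt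
  have h3 := ((M.contMDiff_proj (c.symm y)).mdifferentiableAt (by
    rintro rfl; simp at hm)).hasMFDerivAt
  exact (h2.comp y (h3.comp y h1)).mfderiv

end SpacelikeHypersurface

end GaussianSpacetime

/-! ### Comparison of the volume of a hypersurface with that of a slice. -/

namespace GaussianSpacetime

variable {n : ℕ} {S : Type u} [TopologicalSpace S] [ChartedSpace (Rn n) S]
  [IsManifold (𝓡 n) ∞ S]

/-- `A` expresses the frame `L` in the coordinate frame of `d`, so its determinant is the Jacobian
relating the two densities; it matches the factor in the change of variables formula. -/
theorem sqrt_det_gram_eq (N : GaussianSpacetime n S) (t : ℝ) {d : OpenPartialHomeomorph S (Rn n)}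
    (hd : d ∈ atlas (Rn n) S) {x : S} (hx : x ∈ d.source)
    (L : Rn n →L[ℝ] TangentSpace (𝓡 n) x) (A : Rn n →L[ℝ] Rn n)
    (hA : A = (mfderiv (𝓡 n) (𝓡 n) d x).comp L) :
    √(N.gram t x L).det = |A.det| * volDensity (N.spatialMetric t) d (d x) := by
  obtain ⟨z, hz, rfl⟩ : ∃ z ∈ d.target, d.symm z = x := ⟨d x, d.map_source hx, d.left_inv hx⟩
  obtain ⟨B, rfl⟩ := exists_eq_comp_of_bijective (coordMap_bijective hd hz) L
  have h1 : A = B := by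
    rw [hA]
    have h2 := (mdifferentiable_of_mem_atlas (I := 𝓡 n) hd).comp_symm_deriv hz
    exact congrArg (fun T : Rn n →L[ℝ] Rn n => T.comp B) h2
  rw [d.right_inv hz, volDensity_spatialMetric, det_gram_comp, h1, Real.sqrt_mul (sq_nonneg _),
    Real.sqrt_sq_eq_abs]

namespace SpacelikeHypersurface

variable {N : GaussianSpacetime n S} {m : WithTop ℕ∞}

theorem fderiv_chart_proj_symm_injective (M : SpacelikeHypersurface.{u, v} N m) (hm : 1 ≤ m)
    {c : OpenPartialHomeomorph M.carrier (Rn n)} (hc : c ∈ atlas (Rn n) M.carrier)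
    {d : OpenPartialHomeomorph S (Rn n)} (hd : d ∈ atlas (Rn n) S) {y : Rn n}
    (hy : y ∈ c.target) (hyd : M.proj (c.symm y) ∈ d.source) :
    Function.Injective (fderiv ℝ (fun η => d (M.proj (c.symm η))) y) := by
  have : IsManifold (𝓡 n) 1 M.carrier := .of_le hm
  rw [M.fderiv_chart_proj_symm hm hc hd hy hyd]
  exact ((mdifferentiable_of_mem_atlas (I := 𝓡 n) hd).mfderiv_injective hyd).comp
    ((M.projDeriv_injective _).comp (coordMap_bijective hc hy).1)

theorem isLocalHomeomorph_proj (M : SpacelikeHypersurface.{u, v} N m) (hm : 1 ≤ m) :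
    IsLocalHomeomorph M.proj := by
  refine IsLocalHomeomorph.mk _ fun ξ => ?_
  set c := chartAt (Rn n) ξ
  set d := chartAt (Rn n) (M.proj ξ)
  have hca : c ∈ atlas (Rn n) M.carrier := chart_mem_atlas _ _
  have hda : d ∈ atlas (Rn n) S := chart_mem_atlas _ _
  have hξ : ξ ∈ c.source := mem_chart_source _ _
  have hy : c ξ ∈ c.target := c.map_source hξ
  have hyd : M.proj (c.symm (c ξ)) ∈ d.source := by
    rw [c.left_inv hξ]; exact mem_chart_source _ _
  have hf : ContDiffAt ℝ 1 (fun η => d (M.proj (c.symm η))) (c ξ) :=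
    M.contDiffAt_chart_proj_symm hca hda hm (by simp) hy hyd
  have hinj := M.fderiv_chart_proj_symm_injective hm hca hda hy hyd
  let e' : Rn n ≃L[ℝ] Rn n := (LinearEquiv.ofInjectiveEndo
    (fderiv ℝ (fun η => d (M.proj (c.symm η))) (c ξ) : Rn n →ₗ[ℝ] Rn n)
    hinj).toContinuousLinearEquiv
  have hf' : HasFDerivAt (fun η => d (M.proj (c.symm η))) (e' : Rn n →L[ℝ] Rn n) (c ξ) :=
    (hf.differentiableAt (by simp)).hasFDerivAt
  let e := hf.toOpenPartialHomeomorph _ hf' (by simp)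
  let U : Set M.carrier := c.source ∩ M.proj ⁻¹' d.source
  have hU : IsOpen U := c.open_source.inter (d.open_source.preimage M.contMDiff_proj.continuous)
  -- The inverse function theorem gives `e` in coordinates; restricting to `U` ensures that the
  -- composite with the charts equals the projection.
  refine ⟨((c.trans e).trans d.symm).restrOpen U hU, ?_, ?_⟩
  · have h1 : c ξ ∈ e.source := hf.mem_toOpenPartialHomeomorph_source hf' (by simp)
    have h2 : e (c ξ) = d (M.proj ξ) := congrArg (fun q => d (M.proj q)) (c.left_inv hξ)
    have h3 : d (M.proj ξ) ∈ d.target := mem_chart_target _ _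
    simp only [OpenPartialHomeomorph.restrOpen_source, OpenPartialHomeomorph.trans_source,
      mem_inter_iff, mem_preimage, OpenPartialHomeomorph.symm_source,
      OpenPartialHomeomorph.coe_trans, Function.comp_apply, h2]
    exact ⟨⟨⟨hξ, h1⟩, h3⟩, hξ, mem_chart_source _ _⟩
  · rintro q hq
    have hqU : q ∈ U := hq.2
    have h2 : e (c q) = d (M.proj q) := congrArg (fun q => d (M.proj q)) (c.left_inv hqU.1)
    change M.proj q = d.symm (e (c q))
    rw [h2, d.left_inv hqU.2]

theorem proj_injective [T2Space S] (M : SpacelikeHypersurface.{u, v} N m) (hm : 1 ≤ m) :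
    Function.Injective M.proj :=
  (M.isLocalHomeomorph_proj hm).injective_of_height M.contMDiff_time.continuous M.injective

/-- The volume density of a hypersurface is bounded by that of an earlier slice if the slices in
between are non-expanding. -/
theorem volDensity_le_slice (M : SpacelikeHypersurface.{u, v} N m) (hm : 1 ≤ m) {t : ℝ}
    (ht : t ∈ N.I) (hMt : ∀ ξ, t ≤ M.time ξ)
    (hN : ∀ s ∈ N.I, t ≤ s → ∀ (x : S) (L : Rn n →L[ℝ] TangentSpace (𝓡 n) x),
      Function.Bijective L → 0 ≤ N.sliceCurvature s x L)
    {c : OpenPartialHomeomorph M.carrier (Rn n)} (hc : c ∈ atlas (Rn n) M.carrier)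
    {d : OpenPartialHomeomorph S (Rn n)} (hd : d ∈ atlas (Rn n) S) {y : Rn n}
    (hy : y ∈ c.target) (hyd : M.proj (c.symm y) ∈ d.source) :
    volDensity M.inducedMetric c y ≤ |(fderiv ℝ (fun η => d (M.proj (c.symm η))) y).det| *
      volDensity (N.spatialMetric t) d (d (M.proj (c.symm y))) := by
  have : IsManifold (𝓡 n) 1 M.carrier := .of_le hm
  rw [← N.sqrt_det_gram_eq t hd hyd _ _ (M.fderiv_chart_proj_symm hm hc hd hy hyd)]
  refine (M.volDensity_inducedMetric_le hc hy).trans (Real.sqrt_le_sqrt ?_)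
  have hL : Function.Bijective ((M.projDeriv (c.symm y)).comp (coordMap c y)) :=
    (M.projDeriv_bijective _).comp (coordMap_bijective hc hy)
  exact N.det_gram_antitone ht (M.time_mem _) (hMt _) hL fun r hr =>
    hN r (N.I_ordConnected.out ht (M.time_mem _) hr) hr.1 _ _ hL

/-- Any family competing in the supremum for `M` is cut along a chart partition of `S` and pushed
forward by the injective projection; the pieces form a competitor for the slice with at least as
large a sum. -/
theorem volume_le_slice [T2Space S] [CompactSpace S] [ConnectedSpace S]
    (M : SpacelikeHypersurface.{u, v} N m) (hm : 1 ≤ m) (t : N.I) (hMt : ∀ ξ, t ≤ M.time ξ)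
    (hN : ∀ s ∈ N.I, t ≤ s → ∀ (x : S) (L : Rn n →L[ℝ] TangentSpace (𝓡 n) x),
      Function.Bijective L → 0 ≤ N.sliceCurvature s x L) :
    M.volume ≤ (N.slice t).volume := by
  have : IsManifold (𝓡 n) 1 M.carrier := .of_le hm
  rw [volume_slice]
  refine iSup_le fun k => iSup_le fun c => iSup_le fun A => iSup_le fun ⟨hA, hAd⟩ => ?_
  obtain ⟨l, d, B, hB, hBd, hBu⟩ := exists_finite_measurable_partition (n := n) (M := S)
  borelize M.carrier
  borelize S
  have hpinj := M.proj_injective hm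
  have hpc := M.contMDiff_proj.continuous
  -- An injective continuous map from a compact space to a Hausdorff space is a closed embedding, so
  -- images of Borel sets are Borel.
  have hpm : MeasurableEmbedding M.proj := (hpc.isClosedEmbedding hpinj).measurableEmbedding
  let C : Fin k × Fin l → Set M.carrier := fun p => A p.1 ∩ M.proj ⁻¹' B p.2
  have hCm : ∀ p, MeasurableSet (C p) := fun p =>
    (hA p.1).2.1.inter (hpc.measurable (hB p.2).2.1)
  have hCc : ∀ p, C p ⊆ (c p.1).source := fun p => inter_subset_left.trans (hA p.1).2.2
  have hCd : ∀ p, ∀ ξ ∈ C p, M.proj ξ ∈ (d p.2).source := fun p ξ hξ => (hB p.2).2.2 hξ.2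
  have hpiece : ∀ p, ∫⁻ y in c p.1 '' C p, ENNReal.ofReal (volDensity M.inducedMetric (c p.1) y) ≤
      ∫⁻ z in d p.2 '' (M.proj '' C p),
        ENNReal.ofReal (volDensity (N.spatialMetric t) (d p.2) z) := by
    intro p
    set f : Rn n → Rn n := fun η => d p.2 (M.proj ((c p.1).symm η)) with hf
    have hs : MeasurableSet (c p.1 '' C p) := (c p.1).measurableSet_image (hCm p) (hCc p)
    have himg : d p.2 '' (M.proj '' C p) = f '' (c p.1 '' C p) := by
      rw [image_image, image_image]
      exact image_congr fun ξ hξ => by rw [hf]; simp only [(c p.1).left_inv (hCc p hξ)]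
    have hmem : ∀ y ∈ c p.1 '' C p, y ∈ (c p.1).target ∧ (c p.1).symm y ∈ C p := by
      rintro _ ⟨ξ, hξ, rfl⟩
      refine ⟨(c p.1).map_source (hCc p hξ), ?_⟩
      rwa [(c p.1).left_inv (hCc p hξ)]
    have hfinj : InjOn f (c p.1 '' C p) := by
      intro y hy y' hy' h
      have h1 := (d p.2).injOn (hCd p _ (hmem y hy).2) (hCd p _ (hmem y' hy').2) h
      exact (c p.1).symm.injOn (hmem y hy).1 (hmem y' hy').1 (hpinj h1)
    have hfd : ∀ y ∈ c p.1 '' C p, HasFDerivWithinAt f (fderiv ℝ f y) (c p.1 '' C p) y := by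
      intro y hy
      have h1 : MDifferentiableAt (𝓡 n) (𝓡 n) f y :=
        (((mdifferentiable_of_mem_atlas (I := 𝓡 n) (hB p.2).1).mdifferentiableAt
          (hCd p _ (hmem y hy).2)).comp ((c p.1).symm y) ((M.contMDiff_proj _).mdifferentiableAt
            (by rintro rfl; simp at hm))).comp y
          ((mdifferentiable_of_mem_atlas (I := 𝓡 n) (hA p.1).1).mdifferentiableAt_symm
            (hmem y hy).1)
      exact (mdifferentiableAt_iff_differentiableAt.1 h1).hasFDerivAt.hasFDerivWithinAt
    rw [himg, lintegral_image_eq_lintegral_abs_det_fderiv_mul MeasureTheory.volume hs hfd hfinj]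
    refine setLIntegral_mono' hs fun y hy => ?_
    rw [← ENNReal.ofReal_mul (abs_nonneg _)]
    exact ENNReal.ofReal_le_ofReal (M.volDensity_le_slice hm t.2 hMt hN (hA p.1).1 (hB p.2).1
      (hmem y hy).1 (hCd p _ (hmem y hy).2))
  have hsplit : ∀ i, ∫⁻ y in c i '' A i, ENNReal.ofReal (volDensity M.inducedMetric (c i) y) ≤
      ∑ j, ∫⁻ y in c i '' C (i, j), ENNReal.ofReal (volDensity M.inducedMetric (c i) y) := by
    intro i
    have h1 : c i '' A i ⊆ ⋃ j, c i '' C (i, j) := by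
      rw [← image_iUnion]
      refine image_mono fun ξ hξ => ?_
      obtain ⟨j, hj⟩ := mem_iUnion.1 (hBu.ge (mem_univ (M.proj ξ)))
      exact mem_iUnion.2 ⟨j, hξ, hj⟩
    refine (lintegral_mono_set h1).trans ((lintegral_iUnion_le _ _).trans ?_)
    rw [tsum_fintype]
  calc _ ≤ ∑ i, ∑ j, ∫⁻ y in c i '' C (i, j),
        ENNReal.ofReal (volDensity M.inducedMetric (c i) y) := Finset.sum_le_sum fun i _ => hsplit i
    _ = ∑ p : Fin k × Fin l, ∫⁻ y in c p.1 '' C p,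
        ENNReal.ofReal (volDensity M.inducedMetric (c p.1) y) := by
        rw [← Finset.univ_product_univ, Finset.sum_product]
    _ ≤ ∑ p : Fin k × Fin l, ∫⁻ z in d p.2 '' (M.proj '' C p),
        ENNReal.ofReal (volDensity (N.spatialMetric t) (d p.2) z) :=
        Finset.sum_le_sum fun p _ => hpiece p
    _ ≤ riemVolume (N.spatialMetric t) := by
        refine sum_le_riemVolume _ (fun p : Fin k × Fin l => d p.2) (fun p => M.proj '' C p)
          (fun p => ⟨(hB p.2).1, ?_, ?_⟩) fun p q hpq => ?_
        · have := hpm.measurableSet_image' (hCm p)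
          rwa [← BorelSpace.measurable_eq (α := S)]
        · rintro _ ⟨ξ, hξ, rfl⟩
          exact hCd p ξ hξ
        -- Pieces with the same first index are separated by the partition of `S`, the others by the
        -- family `A`.
        · refine (disjoint_image_iff hpinj).2 ?_
          by_cases h1 : p.1 = q.1
          · have h2 : p.2 ≠ q.2 := fun h2 => hpq (Prod.ext h1 h2)
            exact ((hBd h2).preimage M.proj).mono inter_subset_right inter_subset_right
          · exact (hAd h1).mono inter_subset_left inter_subset_left

end SpacelikeHypersurface

end GaussianSpacetime

/-! ### Mean curvature at critical points of the time function. -/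

namespace GaussianSpacetime

variable {n : ℕ} {S : Type u} [TopologicalSpace S] [ChartedSpace (Rn n) S]

theorem coordMetric_eq (N : GaussianSpacetime n S) (d : OpenPartialHomeomorph S (Rn n))
    (z X Y : ℝ × Rn n) : N.coordMetric d z X Y = Real.exp (2 * N.ψ z.1 (d.symm z.2)) *
      (-(X.1 * Y.1) +
        N.σ z.1 (d.symm z.2) (coordMap d z.2 X.2) (coordMap d z.2 Y.2)) := rfl

theorem coordMetric_space_time (N : GaussianSpacetime n S) (d : OpenPartialHomeomorph S (Rn n))
    (z : ℝ × Rn n) (v : Rn n) (r : ℝ) : N.coordMetric d z (0, v) (r, 0) = 0 := by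
  rw [coordMetric_eq]
  simp

theorem coordMetric_time_right (N : GaussianSpacetime n S) (d : OpenPartialHomeomorph S (Rn n))
    (z X : ℝ × Rn n) (r : ℝ) :
    N.coordMetric d z X (r, 0) = -(Real.exp (2 * N.ψ z.1 (d.symm z.2)) * (X.1 * r)) := by
  rw [coordMetric_eq]
  simp

theorem coordMetric_space_space (N : GaussianSpacetime n S) (d : OpenPartialHomeomorph S (Rn n))
    (z : ℝ × Rn n) (v w : Rn n) : N.coordMetric d z (0, v) (0, w) =
      Real.exp (2 * N.ψ z.1 (d.symm z.2)) *
        N.σ z.1 (d.symm z.2) (coordMap d z.2 v) (coordMap d z.2 w) := by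
  rw [coordMetric_eq]
  simp

variable [IsManifold (𝓡 n) ∞ S]

/-- Time and space directions are orthogonal throughout the chart, so only the term `-∂_Z⟨X, Y⟩/2`
survives. -/
theorem christoffel_space_space_time (N : GaussianSpacetime n S)
    {d : OpenPartialHomeomorph S (Rn n)} (hd : d ∈ atlas (Rn n) S) {z : ℝ × Rn n}
    (hz : z ∈ N.coordDomain d) (v w : Rn n) (r : ℝ) :
    N.christoffel d z (0, v) (0, w) (r, 0) =
      -(r / 2 * deriv (fun s => Real.exp (2 * N.ψ s (d.symm z.2)) *
        N.σ s (d.symm z.2) (coordMap d z.2 v) (coordMap d z.2 w)) z.1) := by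
  have h1 : DifferentiableAt ℝ (fun z : ℝ × Rn n => Real.exp (2 * N.ψ z.1 (d.symm z.2)) *
      N.σ z.1 (d.symm z.2) (coordMap d z.2 v) (coordMap d z.2 w)) z :=
    ((N.contDiffOn_spatial hd v w).contDiffAt
      ((N.isOpen_coordDomain d).mem_nhds hz)).differentiableAt (by simp)
  have h2 := (HasFDerivAt.comp_hasDerivAt z.1 h1.hasFDerivAt
    ((hasDerivAt_id z.1).prodMk (hasDerivAt_const z.1 z.2))).deriv
  have h3 : ((r, 0) : ℝ × Rn n) = r • (1, 0) := by simp
  simp only [christoffel, coordMetric_space_time, coordMetric_space_space]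
  rw [h3, map_smul, ← h2]
  simp only [fderiv_fun_const, Pi.zero_apply, zero_apply, smul_eq_mul, Function.comp_def, id]
  ring

namespace SpacelikeHypersurface

variable {N : GaussianSpacetime n S} {m : WithTop ℕ∞}

/-- The Hessian of the time function in coordinates, at `ξ`. -/
noncomputable def timeHessian (M : SpacelikeHypersurface.{u, v} N m) (ξ : M.carrier) :
    Matrix (Fin n) (Fin n) ℝ :=
  Matrix.of fun i j =>
    fderiv ℝ (fderiv ℝ fun η => M.time ((chartAt (Rn n) ξ).symm η)) (M.center ξ)
      (EuclideanSpace.single i 1) (EuclideanSpace.single j 1)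

/-- The mean curvature at a critical point of the time function. -/
theorem exists_meanCurvature_eq (M : SpacelikeHypersurface.{u, v} N m) (hm : 2 ≤ m) (ξ : M.carrier)
    (hcrit : fderiv ℝ (fun η => M.time ((chartAt (Rn n) ξ).symm η)) (M.center ξ) = 0) :
    ∃ L : Rn n →L[ℝ] TangentSpace (𝓡 n) (M.proj ξ), Function.Bijective L ∧
      M.meanCurvature ξ = N.sliceCurvature (M.time ξ) (M.proj ξ) L -
        Real.exp (N.ψ (M.time ξ) (M.proj ξ)) *
          ((N.gram (M.time ξ) (M.proj ξ) L)⁻¹ * M.timeHessian ξ).trace := by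
  have hm1 : 1 ≤ m := le_trans (by norm_num) hm
  set c := chartAt (Rn n) ξ with hc
  set d := M.ambientChart ξ with hd
  set y := M.center ξ with hy
  have hca : c ∈ atlas (Rn n) M.carrier := chart_mem_atlas _ _
  have hda : d ∈ atlas (Rn n) S := chart_mem_atlas _ _
  have hξ : ξ ∈ c.source := mem_chart_source _ _
  have hyt : y ∈ c.target := c.map_source hξ
  have hcy : c.symm y = ξ := c.left_inv hξ
  have hyd : M.proj (c.symm y) ∈ d.source := by rw [hcy]; exact mem_chart_source _ _
  set z := M.localRep ξ y with hz
  have hz1 : z.1 = M.time ξ := congrArg M.time hcy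
  have hz2 : d.symm z.2 = M.proj ξ := (d.left_inv hyd).trans (congrArg M.proj hcy)
  have hzdom : z ∈ N.coordDomain d := ⟨M.time_mem _, d.map_source hyd⟩
  rw [← hz1, ← hz2]
  set u : Rn n → ℝ := fun η => M.time (c.symm η) with hu
  set p : Rn n → Rn n := fun η => d (M.proj (c.symm η)) with hp
  have hu2 : ContDiffAt ℝ 2 u y := (M.contDiffAt_time_symm hca hyt).of_le hm
  have hp2 : ContDiffAt ℝ 2 p y := M.contDiffAt_chart_proj_symm hca hda hm
    (WithTop.coe_le_coe.2 le_top) hyt hyd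
  have hrep : M.localRep ξ = fun η => (u η, p η) := rfl
  set J := fderiv ℝ p y with hJ
  have hJinj : Function.Injective J :=
    M.fderiv_chart_proj_symm_injective hm1 hca hda hyt hyd
  have hJbij : Function.Bijective J :=
    ⟨hJinj, LinearMap.surjective_of_injective (f := (J : Rn n →ₗ[ℝ] Rn n)) hJinj⟩
  have hKbij : Function.Bijective (coordMap d z.2) := coordMap_bijective hda hzdom.2
  -- At a critical point the tangent space is that of the slice, so the normal is vertical.
  have hD : ∀ v, fderiv ℝ (M.localRep ξ) y v = (0, J v) := fun v => by
    rw [hrep, (hu2.differentiableAt (by simp)).fderiv_prodMk (hp2.differentiableAt (by simp)),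
      hcrit]
    rfl
  refine ⟨(coordMap d z.2).comp J, hKbij.comp hJbij, ?_⟩
  set L := (coordMap d z.2).comp J with hL
  set ψ := N.ψ z.1 (d.symm z.2) with hψ
  have hE2 : Real.exp (2 * ψ) = Real.exp ψ * Real.exp ψ := by rw [← Real.exp_add, two_mul]
  have hEE : Real.exp ψ * Real.exp (-ψ) = 1 := by rw [← Real.exp_add]; simp
  have hfirst : M.firstForm ξ = N.gram z.1 (d.symm z.2) L := by
    ext i j
    simp only [firstForm, Matrix.of_apply]
    rw [← hd, ← hy, ← hz, hD, hD, coordMetric_space_space, gram_apply]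
    rfl
  have hν0 : M.IsPastUnitNormal ξ (-Real.exp (-ψ), 0) := by
    refine ⟨fun v => ?_, ?_, neg_neg_of_pos (Real.exp_pos _)⟩
    · rw [← hy, hD, coordMetric_space_time]
    · rw [← hd, ← hy, ← hz, coordMetric_time_right]
      change -(Real.exp (2 * ψ) * (-Real.exp (-ψ) * -Real.exp (-ψ))) = -1
      rw [hE2]
      linear_combination (-Real.exp ψ * Real.exp (-ψ) - 1) * hEE
  -- The normal is an `epsilon` choice, so uniqueness is needed: orthogonality to all `(0, J w)`
  -- with `J` surjective kills the spatial part, and normalization with the sign fixes the time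
  -- part.
  have hν : M.pastUnitNormal ξ = (-Real.exp (-ψ), 0) := by
    obtain ⟨h1, h2, h3⟩ : M.IsPastUnitNormal ξ (M.pastUnitNormal ξ) :=
      Classical.epsilon_spec (p := M.IsPastUnitNormal ξ) ⟨_, hν0⟩
    rw [← hd, ← hy, ← hz] at h1 h2
    set ν := M.pastUnitNormal ξ with hνdef
    have h4 : ν.2 = 0 := by
      obtain ⟨w, hw⟩ := hJbij.2 ν.2
      have h5 := h1 w
      rw [hD, hw, coordMetric_eq] at h5
      simp only [zero_mul, neg_zero, zero_add, mul_eq_zero, (Real.exp_pos _).ne', false_or] at h5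
      by_contra hne
      refine (N.σ_pos z.1 hzdom.1.1 hzdom.1.2 (d.symm z.2) (coordMap d z.2 ν.2) ?_).ne' h5
      exact fun h0 => hne (hKbij.1 (h0.trans (map_zero _).symm))
    have h5 : ν = (ν.1, 0) := Prod.ext rfl h4
    rw [h5, coordMetric_time_right] at h2
    change -(Real.exp (2 * ψ) * (ν.1 * ν.1)) = -1 at h2
    rw [hE2] at h2
    have h6 : (Real.exp ψ * ν.1 - 1) * (Real.exp ψ * ν.1 + 1) = 0 := by linear_combination -h2
    have h7 : Real.exp ψ * ν.1 < 0 := mul_neg_of_pos_of_neg (Real.exp_pos _) h3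
    have h8 : Real.exp ψ * ν.1 + 1 = 0 := by
      rcases mul_eq_zero.1 h6 with h | h
      · linarith
      · exact h
    rw [h5, show ν.1 = -Real.exp (-ψ) by
      linear_combination Real.exp (-ψ) * h8 - ν.1 * hEE]
  have hhess : ∀ i j : Fin n, (fderiv ℝ (fun η => fderiv ℝ (M.localRep ξ) η
      (EuclideanSpace.single j 1)) y (EuclideanSpace.single i 1)).1 = M.timeHessian ξ i j := by
    intro i j
    set w : Rn n := EuclideanSpace.single j 1
    have hr2 : ContDiffAt ℝ 2 (M.localRep ξ) y := hu2.prodMk hp2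
    have h1 : ContDiffAt ℝ 1 (fderiv ℝ (M.localRep ξ)) y := hr2.fderiv_right (by norm_num)
    have h2 : DifferentiableAt ℝ (fun η => fderiv ℝ (M.localRep ξ) η w) y :=
      (h1.differentiableAt (by simp)).clm_apply (differentiableAt_const w)
    have h3 : ContDiffAt ℝ 1 (fderiv ℝ u) y := hu2.fderiv_right (by norm_num)
    have h4 : (fun η => (fderiv ℝ (M.localRep ξ) η w).1) =ᶠ[𝓝 y] fun η => fderiv ℝ u η w := by
      filter_upwards [hu2.eventually (by simp), hp2.eventually (by simp)] with η hη1 hη2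
      rw [hrep, (hη1.differentiableAt (by simp)).fderiv_prodMk (hη2.differentiableAt (by simp))]
      rfl
    have h5 := h2.hasFDerivAt.fst.congr_of_eventuallyEq h4.symm
    have h6 := ((h3.differentiableAt (by simp)).hasFDerivAt.clm_apply (hasFDerivAt_const w y))
    have h7 := congrArg (fun T : Rn n →L[ℝ] ℝ => T (EuclideanSpace.single i 1)) (h5.unique h6)
    refine h7.trans ?_
    simp [timeHessian, w, u, c, y]
  -- Only the time component of `∂_i ∂_j x` pairs with the vertical normal; it gives the Hessian
  -- term, and the Christoffel symbol gives the slice term.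
  have hsecond : M.secondForm ξ = -(Real.exp ψ • M.timeHessian ξ + (Real.exp (-ψ) / 2) •
      Matrix.of fun i j => deriv (fun s => N.gram s (d.symm z.2) L i j) z.1) := by
    ext i j
    simp only [secondForm, Matrix.of_apply, Matrix.neg_apply, Matrix.add_apply, Matrix.smul_apply,
      smul_eq_mul]
    rw [← hd, ← hy, ← hz, hD, hD, hν, coordMetric_time_right, hhess,
      N.christoffel_space_space_time hda hzdom]
    change -(-(Real.exp (2 * ψ) * (M.timeHessian ξ i j * -Real.exp (-ψ))) +
      -(-Real.exp (-ψ) / 2 * deriv (fun s => N.gram s (d.symm z.2) L i j) z.1)) = _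
    rw [hE2]
    linear_combination (-Real.exp ψ * M.timeHessian ξ i j) * hEE
  rw [meanCurvature, hfirst, hsecond, N.sliceCurvature_eq_trace ⟨hzdom.1.1, hzdom.1.2⟩,
    mul_neg, mul_add, Matrix.trace_neg, Matrix.trace_add, Matrix.mul_smul, Matrix.mul_smul,
    Matrix.trace_smul, Matrix.trace_smul, smul_eq_mul, smul_eq_mul]
  ring

/-- At a minimum of the time function the mean curvature is at most that of the slice which
touches the hypersurface from below. -/
theorem exists_meanCurvature_le (M : SpacelikeHypersurface.{u, v} N m) (hm : 2 ≤ m) {ξ : M.carrier}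
    (hmin : ∀ η, M.time ξ ≤ M.time η) :
    ∃ L : Rn n →L[ℝ] TangentSpace (𝓡 n) (M.proj ξ), Function.Bijective L ∧
      M.meanCurvature ξ ≤ N.sliceCurvature (M.time ξ) (M.proj ξ) L := by
  set u : Rn n → ℝ := fun η => M.time ((chartAt (Rn n) ξ).symm η) with hu
  have hcy : (chartAt (Rn n) ξ).symm (M.center ξ) = ξ :=
    (chartAt (Rn n) ξ).left_inv (mem_chart_source _ _)
  have hloc : IsLocalMin u (M.center ξ) := by
    refine Eventually.of_forall fun η => ?_
    change M.time ((chartAt (Rn n) ξ).symm (M.center ξ)) ≤ _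
    rw [hcy]
    exact hmin _
  obtain ⟨L, hL, h⟩ := M.exists_meanCurvature_eq hm ξ hloc.fderiv_eq_zero
  refine ⟨L, hL, ?_⟩
  have hu2 : ContDiffAt ℝ 2 u (M.center ξ) := (M.contDiffAt_time_symm (chart_mem_atlas _ _)
    (mem_chart_target _ _)).of_le hm
  have hd : DifferentiableAt ℝ (fderiv ℝ u) (M.center ξ) :=
    (hu2.fderiv_right (m := 1) (by norm_num)).differentiableAt (by simp)
  have hnonneg : 0 ≤ ((N.gram (M.time ξ) (M.proj ξ) L)⁻¹ * M.timeHessian ξ).trace := by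
    refine (N.gram_posDef (M.time_mem ξ) _ hL.1).trace_inv_mul_nonneg fun v => ?_
    let V : Rn n := WithLp.toLp 2 v
    have h1 := hloc.fderiv_fderiv_nonneg hu2 V
    have h2 : fderiv ℝ (fun η => fderiv ℝ u η V) (M.center ξ) V =
        fderiv ℝ (fderiv ℝ u) (M.center ξ) V V := by
      rw [(hd.hasFDerivAt.clm_apply (hasFDerivAt_const V _)).fderiv]
      simp
    rw [h2] at h1
    refine h1.trans_eq ?_
    set H := fderiv ℝ (fderiv ℝ u) (M.center ξ) with hH
    have h3 : ∀ w, H V w = ∑ i, v i * H (EuclideanSpace.single i 1) w := fun w => by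
      have := EuclideanSpace.map_eq_sum_single (H : Rn n →ₗ[ℝ] (Rn n →L[ℝ] ℝ)) V
      have := congrArg (fun T : Rn n →L[ℝ] ℝ => T w) this
      simpa [V] using this
    rw [h3]
    refine Finset.sum_congr rfl fun i _ => ?_
    have h4 := EuclideanSpace.map_eq_sum_single
      (H (EuclideanSpace.single i 1) : Rn n →ₗ[ℝ] ℝ) V
    have h5 : H (EuclideanSpace.single i 1) V = ∑ j, v j *
        H (EuclideanSpace.single i 1) (EuclideanSpace.single j 1) := h4
    rw [h5]
    congr 1
    refine Finset.sum_congr rfl fun j _ => mul_comm _ _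
  rw [h]
  linarith [mul_nonneg (Real.exp_pos (N.ψ (M.time ξ) (M.proj ξ))).le hnonneg]

end SpacelikeHypersurface

/-- On a slice the time function is constant, so every point is critical with vanishing Hessian;
frame independence then allows any `L`. -/
theorem meanCurvature_slice [CompactSpace S] [ConnectedSpace S] (N : GaussianSpacetime n S)
    (t : N.I) (x : S) {L : Rn n →L[ℝ] TangentSpace (𝓡 n) x} (hL : Function.Bijective L) :
    (N.slice t).meanCurvature x = N.sliceCurvature t x L := by
  have h0 : fderiv ℝ (fun η => (N.slice t).time
      ((chartAt (Rn n) (M := (N.slice t).carrier) x).symm η)) = 0 :=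
    fderiv_const (t : ℝ)
  obtain ⟨L', hL', h⟩ := (N.slice t).exists_meanCurvature_eq (WithTop.coe_le_coe.2 le_top) x
    (congrFun h0 _)
  have hU : (N.slice t).timeHessian x = 0 := by
    ext i j
    simp only [SpacelikeHypersurface.timeHessian, Matrix.of_apply, Matrix.zero_apply]
    rw [h0, fderiv_zero]
    rfl
  rw [h, hU, Matrix.mul_zero, Matrix.trace_zero, mul_zero, sub_zero]
  exact N.sliceCurvature_congr t hL hL'

/-- There are arbitrarily late slices of small volume. -/
theorem exists_slice_volume_le [CompactSpace S] [ConnectedSpace S] (N : GaussianSpacetime n S)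
    (hvol : Tendsto (fun t : N.I => (N.slice t).volume)
      (comap (fun t : N.I => ((t : ℝ) : EReal)) (𝓝 N.b)) (𝓝 0)) {a : ℝ} (ha : a ∈ N.I)
    {ε : ℝ≥0∞} (hε : 0 < ε) : ∃ t : N.I, a ≤ t ∧ (N.slice t).volume ≤ ε := by
  obtain ⟨U, hU, hUε⟩ := (ENNReal.tendsto_nhds_zero.1 hvol ε hε)
  obtain ⟨l, hl, hlU⟩ := exists_Ioc_subset_of_mem_nhds hU ⟨(a : EReal), ha.2⟩
  -- A neighbourhood of `b` in `EReal` contains some `(l, b]`, also when `b = ∞`; a real `t` between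
  -- `max l a` and `b` lies in it.
  obtain ⟨t, ht1, ht2⟩ := EReal.lt_iff_exists_real_btwn.1 (max_lt hl ha.2)
  have hat : (a : EReal) < t := (le_max_right _ _).trans_lt ht1
  refine ⟨⟨t, ha.1.trans hat, ht2⟩, (EReal.coe_lt_coe_iff.1 hat).le, hUε ?_⟩
  exact hlU ⟨(le_max_left _ _).trans_lt ht1, ht2.le⟩

end GaussianSpacetime

/-! ### The two volume limits. -/

theorem mainTheorem9 {n : ℕ} {S : Type u} [TopologicalSpace S] [ChartedSpace (Rn n) S]
    [IsManifold (𝓡 n) ∞ S] [T2Space S] [CompactSpace S] [ConnectedSpace S]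
    (N : GaussianSpacetime n S) (a₀ : ℝ) (ha₀ : a₀ ∈ N.I)
    (hH : ∀ t : N.I, a₀ ≤ t → ∀ x : (N.slice t).carrier, 0 ≤ (N.slice t).meanCurvature x)
    (hvol : Tendsto (fun t : N.I => (N.slice t).volume)
      (comap (fun t : N.I => ((t : ℝ) : EReal)) (𝓝 N.b)) (𝓝 0)) :
    (∀ M : ℕ → GaussianSpacetime.SpacelikeHypersurface.{u, v} N 1,
      Tendsto (fun k => ⨅ ξ : (M k).carrier, ((M k).time ξ : EReal)) atTop (𝓝 N.b) →
      Tendsto (fun k => (M k).volume) atTop (𝓝 0)) ∧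
    (∀ (a₁ τ₀ : ℝ) (M : ℝ → GaussianSpacetime.SpacelikeHypersurface.{u, v} N 2),
      a₁ ∈ N.I →
      (∀ τ, τ₀ < τ → ∀ ξ : (M τ).carrier, a₁ ≤ (M τ).time ξ ∧ (M τ).meanCurvature ξ = τ) →
      Tendsto (fun τ => (M τ).volume) atTop (𝓝 0)) := by
  have hN : ∀ t : N.I, a₀ ≤ t → ∀ s ∈ N.I, (t : ℝ) ≤ s → ∀ (x : S)
      (L : Rn n →L[ℝ] TangentSpace (𝓡 n) x), Function.Bijective L →
      0 ≤ N.sliceCurvature s x L := fun t ht s hs hts x L hL => by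
    rw [← N.meanCurvature_slice ⟨s, hs⟩ x hL]
    exact hH ⟨s, hs⟩ (ht.trans hts) x
  refine ⟨fun M hM => ENNReal.tendsto_nhds_zero.2 fun ε hε => ?_,
    fun a₁ τ₀ M ha₁ hM => ENNReal.tendsto_nhds_zero.2 fun ε hε => ?_⟩
  · obtain ⟨t, ht, htε⟩ := N.exists_slice_volume_le hvol ha₀ hε
    filter_upwards [hM.eventually (lt_mem_nhds t.2.2)] with k hk
    refine ((M k).volume_le_slice le_rfl t (fun ξ => ?_) (hN t ht)).trans htε
    exact EReal.coe_le_coe_iff.1 (hk.le.trans (iInf_le _ ξ))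
  · have ha : max a₀ a₁ ∈ N.I := by
      rcases max_choice a₀ a₁ with h | h <;> rwa [h]
    obtain ⟨t, ht, htε⟩ := N.exists_slice_volume_le hvol ha hε
    -- The slice `t` is fixed before `τ`, so the curvature bound `C` on `[a₁, t]` does not depend on
    -- `τ`.
    obtain ⟨C, hC⟩ := N.exists_sliceCurvature_le ha₁ t.2
    filter_upwards [eventually_gt_atTop (max τ₀ C)] with τ hτ
    have hMτ := hM τ ((le_max_left _ _).trans_lt hτ)
    refine ((M τ).volume_le_slice (by norm_num) t (fun η => ?_)
      (hN t ((le_max_left _ _).trans ht))).trans htε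
    obtain ⟨ξ, -, hξ⟩ := isCompact_univ.exists_isMinOn univ_nonempty
      (M τ).contMDiff_time.continuous.continuousOn
    have hmin : ∀ η, (M τ).time ξ ≤ (M τ).time η := fun η => hξ (mem_univ η)
    refine le_trans ?_ (hmin η)
    -- A minimum before `t` would lie in `[a₁, t]` and give `τ ≤ C`, against the choice `τ > C`.
    by_contra! hlt
    obtain ⟨L, hL, hle⟩ := (M τ).exists_meanCurvature_le le_rfl hmin
    rw [(hMτ ξ).2] at hle
    have := hC _ ⟨(hMτ ξ).1, hlt.le⟩ _ L hL
    linarith [le_max_right τ₀ C]
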